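/- **Proposition 2.1.** Fix an integer $q\ge 1$. For a finite multigraph $G=(V,E)$ (loops and parallel edges allowed) and $\beta>0$ let $$Z_\beta(G)=\sum_{\sigma\in[q]^V}\ \prod_{vw\in E}\Bigl(1-(1-e^{-\beta})\mathbf 1\{\sigma(v)=\sigma(w)\}\Bigr)$$ be the partition function of the $q$-spin Potts antiferromagnet on $G$, each edge being counted with its multiplicity. Let $\mathbb G$ be one of the following random graphs with $n$ labelled vertices, and let $\boldsymbol G$ be the associated sparsified random multigraph with parameter $\varepsilon\in(0,1]$: * *Binomial case* ($d>0$ a fixed real number): $\mathbb G=\mathbb G(n,d/n)$ is the binomial random graph, and $\boldsymbol G$ consists of $\boldsymbol m$ independent edges, each chosen uniformly out of all $\binom n2$ possible edges. * *Regular case* ($d\ge 1$ a fixed integer): $\mathbb G=\mathbb G(n,d)$ is a uniformly random simple $d$-regular graph (for $dn$ even), and $\boldsymbol G$ is obtained by choosing a uniformly random matching of size $\boldsymbol m$ of the complete graph on $[n]\times[d]$ and inserting one $vw$-edge for every matching edge $\{(v,i),(w,j)\}$. In both cases $\boldsymbol m$ is a Poisson variable of mean $(1-\varepsilon)dn/2$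 conditioned on not exceeding $dn/2$. Then in either case, for any $\varepsilon\in(0,1]$ and any $\delta,\beta>0$ there is $\xi>0$ (which may depend on $q,d,\varepsilon,\delta,\beta$, but not on $n$) such that for all large enough $n$ $$\Pr\Bigl[\bigl|\log Z_\beta(\mathbb G)-\mathbb E[\log Z_\beta(\mathbb G)]\bigr|>\delta n\Bigr]\le e^{-\xi n},\qquad \Pr\Bigl[\bigl|\log Z_\beta(\boldsymbol G)-\mathbb E[\log Z_\beta(\boldsymbol G)]\bigr|>\delta n\Bigr]\le e^{-\xi n},$$ where in the regular case the first inequality is claimed for those large $n$ for which $dn$ is even. -/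

import Mathlib

open MeasureTheory ProbabilityTheory Filter
open scoped ENNReal

/-- A multigraph on the vertex set `V`: a finite multiset of undirected edges. Loops and parallel
edges are allowed; the multiplicity of an edge is its multiplicity in the multiset. -/
structure Multigraph (V : Type*) where
  edges : Multiset (Sym2 V)

/-- Every set of multigraphs is an event. -/
instance (V : Type*) : MeasurableSpace (Multigraph V) := ⊤

instance (V : Type*) : DiscreteMeasurableSpace (Multigraph V) := ⟨fun _ => trivial⟩

/-- A finite simple graph, viewed as a multigraph. -/
noncomputable def SimpleGraph.toMultigraph {V : Type*} [Finite V] (G : SimpleGraph V) :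
    Multigraph V :=
  ⟨G.edgeSet.toFinite.toFinset.val⟩

open Classical in
/-- The factor `1 - (1 - exp (-β)) 𝟙{σ v = σ w}` that the edge `e = vw` contributes. The pair
`{σ v, σ w}` is on the diagonal exactly if `σ v = σ w`. -/
noncomputable def edgeWeight {V : Type*} {q : ℕ} (β : ℝ) (σ : V → Fin q) (e : Sym2 V) : ℝ :=
  1 - (1 - Real.exp (-β)) * (if (e.map σ).IsDiag then 1 else 0)

open Classical in
/-- The partition function `Z_β(G)` of the `q`-spin Potts antiferromagnet on the multigraph `G` at
inverse temperature `β`. -/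
noncomputable def Multigraph.partitionFunction {V : Type*} [Fintype V] (q : ℕ) (β : ℝ)
    (G : Multigraph V) : ℝ :=
  ∑ σ : V → Fin q, (G.edges.map (edgeWeight β σ)).prod

/-- The random variable `log Z_β(G)` on multigraphs. -/
noncomputable def Multigraph.logZ {V : Type*} [Fintype V] (q : ℕ) (β : ℝ) (G : Multigraph V) : ℝ :=
  Real.log (G.partitionFunction q β)

/-- The probability under `μ` that the random variable `X` differs from its mean by more
than `t`. -/
noncomputable def deviationProb {Ω : Type*} [MeasurableSpace Ω] (μ : Measure Ω) (X : Ω → ℝ)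
    (t : ℝ) : ℝ :=
  μ.real {ω | |X ω - ∫ ω', X ω' ∂μ| > t}

/-- The law of the binomial random graph `G(n, d/n)`. The edge probability is `d/n`, cut off
at `1` for those finitely many `n` with `n < d`. -/
noncomputable def binomialGraph (d : ℝ) (n : ℕ) : Measure (SimpleGraph (Fin n)) :=
  SimpleGraph.binomialRandom (Fin n) (Set.projIcc (0 : ℝ) 1 zero_le_one (d / n))

open Classical in
/-- The law of the random regular graph `G(n, d)`: the uniform distribution on the simple
`d`-regular graphs with `n` labelled vertices. -/
noncomputable def regularGraph (d n : ℕ) : Measure (SimpleGraph (Fin n)) :=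
  uniformOn {G : SimpleGraph (Fin n) | G.IsRegularOfDegree d}

/-- The law of `f a`, for `a` chosen uniformly at random from the nonempty finite set `s`. -/
noncomputable def uniformLaw {α Ω : Type*} [MeasurableSpace Ω] (s : Finset α) (f : α → Ω) :
    Measure Ω :=
  (s.card : ℝ≥0∞)⁻¹ • ∑ a ∈ s, Measure.dirac (f a)

/-- The law of the number of edges of the sparsified multigraphs: a Poisson variable
of mean `(1 - ε) d n / 2`, conditioned on not exceeding `d n / 2`. -/
noncomputable def edgeNumber (ε d : ℝ) (n : ℕ) : Measure ℕ :=
  cond (poissonMeasure ((1 - ε) * d * n / 2).toNNReal) {m : ℕ | (m : ℝ) ≤ d * n / 2}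

open Classical in
/-- The law of the multigraph with vertex set `Fin n` and `m` independent edges, each of them
uniform among the `n.choose 2` pairs of distinct vertices. -/
noncomputable def independentEdges (n m : ℕ) : Measure (Multigraph (Fin n)) :=
  uniformLaw (Fintype.piFinset fun _ : Fin m => {e : Sym2 (Fin n) | ¬ e.IsDiag})
    (fun e => ⟨Finset.univ.val.map e⟩)

/-- The law of the sparsified multigraph of the binomial random graph: `m` independent uniformly
random edges, with a random number `m` of edges distributed as `edgeNumber ε d n`. -/
noncomputable def sparsifiedBinomial (ε d : ℝ) (n : ℕ) : Measure (Multigraph (Fin n)) :=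
  (edgeNumber ε d n).bind (independentEdges n)

open Classical in
/-- The matchings of size `m` of the complete graph on `X`, as sets of pairwise
disjoint edges. -/
noncomputable def matchings (X : Type*) [Fintype X] (m : ℕ) : Finset (Finset (Sym2 X)) :=
  {M | M.card = m ∧ (∀ e ∈ M, ¬ e.IsDiag) ∧ ∀ e ∈ M, ∀ f ∈ M, e ≠ f → ∀ x ∈ e, x ∉ f}

/-- The law of the multigraph obtained from a uniformly random matching of size `m` of the complete
graph on `Fin n × Fin d`, by inserting one `vw`-edge for every matching
edge `{(v, i), (w, j)}`. -/
noncomputable def configurationModel (d n m : ℕ) : Measure (Multigraph (Fin n)) :=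
  uniformLaw (matchings (Fin n × Fin d) m) (fun M => ⟨M.val.map (Sym2.map Prod.fst)⟩)

/-- The law of the sparsified multigraph of the random regular graph: the configuration model with
a random number of matching edges distributed as `edgeNumber ε d n`. -/
noncomputable def sparsifiedRegular (ε : ℝ) (d n : ℕ) : Measure (Multigraph (Fin n)) :=
  (edgeNumber ε d n).bind (configurationModel d n)

/-! Every edge weight lies in [e^{-β}, 1], so inserting or deleting one edge moves log Z by at most
β. The concentration arguments run through `LocalMGFBound`, a bound exp(t²v) on centred exponential
moments for |t| r ≤ 1. When v = O(n) and r = O(1), Chernoff's inequality at a fixed small t bounds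
deviations of order n by exp(-Ω(n)). `LocalMGFBound.combine` is the martingale step;
`localMGFBound_pi` and `localMGFBound_perm` iterate it over independent coordinates and over a
uniform permutation.

In the binomial graph there are about n² edge indicators, but each has variance at most d/n, so v is
still linear in n. Independent edges are linearly many coordinates. A uniform matching is the image
of a fixed matching under a uniform permutation, and a transposition alters at most two of its
edges. A random edge number is handled in `exists_rate_mixture`: the number itself concentrates, and
the conditional mean of log Z moves by at most β per edge.

The uniform regular graph is the configuration model conditioned on simplicity, because every simple
regular graph has equally many configurations (`exists_card_fiber_projectEdges`). A polynomial lower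
bound on the probability of simplicity is enough, since exponential tails absorb polynomial factors.
It comes from switchings (`factorial_le_mul_card_injective`): by a first moment bound half of all
permutations have at most a constant number of defects, and removing defects by transpositions costs
a factor (nd)² each. The tail bound so obtained is centred at the mean of the configuration model;
`exists_rate_deviationProb` recentres it, as log Z stays within O(n) of that centre. -/

/-- The mean of `f` with respect to the weight function `w` on a finite type. -/
noncomputable def wmean {Ω : Type*} [Fintype Ω] (w f : Ω → ℝ) : ℝ := ∑ x, w x * f x

/-- A weight function on a finite type that defines a probability distribution. -/
structure IsWeight {Ω : Type*} [Fintype Ω] (w : Ω → ℝ) : Prop where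
  nonneg : ∀ x, 0 ≤ w x
  sum_eq_one : ∑ x, w x = 1

/-- The centred exponential moments of `f` of order `t` with `|t| r ≤ 1` are at most
`exp (t² v)`. -/
def LocalMGFBound {Ω : Type*} [Fintype Ω] (w f : Ω → ℝ) (r v : ℝ) : Prop :=
  ∀ t : ℝ, |t| * r ≤ 1 → wmean w (fun x => Real.exp (t * (f x - wmean w f))) ≤ Real.exp (t ^ 2 * v)

/-- The uniform weight function. -/
noncomputable def unifWeight (Ω : Type*) [Fintype Ω] : Ω → ℝ := fun _ => (Fintype.card Ω : ℝ)⁻¹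

lemma isWeight_unifWeight (Ω : Type*) [Fintype Ω] [Nonempty Ω] : IsWeight (unifWeight Ω) where
  nonneg _ := by unfold unifWeight; positivity
  sum_eq_one := by simp [unifWeight]

/-! ### Weighted means on finite types -/

section wmean

variable {Ω : Type*} [Fintype Ω] {w : Ω → ℝ}

lemma wmean_mono (hw : ∀ x, 0 ≤ w x) {f g : Ω → ℝ} (h : ∀ x, f x ≤ g x) :
    wmean w f ≤ wmean w g :=
  Finset.sum_le_sum fun x _ => mul_le_mul_of_nonneg_left (h x) (hw x)

lemma wmean_const (hw : IsWeight w) (c : ℝ) : wmean w (fun _ => c) = c := by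
  simp [wmean, ← Finset.sum_mul, hw.sum_eq_one]

lemma wmean_add (f g : Ω → ℝ) : wmean w (fun x => f x + g x) = wmean w f + wmean w g := by
  simp [wmean, mul_add, Finset.sum_add_distrib]

lemma wmean_sub (f g : Ω → ℝ) : wmean w (fun x => f x - g x) = wmean w f - wmean w g := by
  simp [wmean, mul_sub, Finset.sum_sub_distrib]

lemma wmean_mul_left (c : ℝ) (f : Ω → ℝ) : wmean w (fun x => c * f x) = c * wmean w f := by
  simp [wmean, Finset.mul_sum, mul_left_comm]

lemma abs_wmean_le (hw : IsWeight w) {f : Ω → ℝ} {c : ℝ} (h : ∀ x, |f x| ≤ c) :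
    |wmean w f| ≤ c := by
  rw [abs_le]
  constructor
  · rw [← wmean_const hw (-c)]
    exact wmean_mono hw.nonneg fun x => (abs_le.1 (h x)).1
  · rw [← wmean_const hw c]
    exact wmean_mono hw.nonneg fun x => (abs_le.1 (h x)).2

lemma wmean_unifWeight_equiv {Ω' : Type*} [Fintype Ω'] (e : Ω ≃ Ω') (f : Ω' → ℝ) :
    wmean (unifWeight Ω') f = wmean (unifWeight Ω) (fun x => f (e x)) := by
  simp only [wmean, unifWeight, Fintype.card_congr e]
  exact (Equiv.sum_comp e _).symm

lemma wmean_unifWeight_prod {A B : Type*} [Fintype A] [Fintype B] (h : A × B → ℝ) :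
    wmean (unifWeight (A × B)) h =
      wmean (unifWeight A) (fun a => wmean (unifWeight B) fun b => h (a, b)) := by
  simp only [wmean, unifWeight, Fintype.card_prod, Fintype.sum_prod_type, Finset.mul_sum]
  refine Finset.sum_congr rfl fun a _ => Finset.sum_congr rfl fun b _ => ?_
  push_cast
  rw [mul_inv]
  ring

end wmean

/-! ### Exponential moment bounds and Chernoff's inequality -/

section LocalMGFBound

variable {Ω : Type*} [Fintype Ω] {w : Ω → ℝ}

/-- A function of bounded oscillation satisfies an exponential moment bound in terms of its
second moment around an arbitrary point. -/
lemma localMGFBound_of_sq_le (hw : IsWeight w) {f : Ω → ℝ} {r v : ℝ}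
    (hf : ∀ x y, |f x - f y| ≤ r) (x₀ : Ω) (hv : wmean w (fun x => (f x - f x₀) ^ 2) ≤ v) :
    LocalMGFBound w f r v := by
  intro t ht
  set m := wmean w f with hm
  have hc : ∀ x, |f x - m| ≤ r := by
    intro x
    have : f x - m = wmean w (fun y => f x - f y) := by
      rw [wmean_sub, wmean_const hw]
    rw [this]
    exact abs_wmean_le hw fun y => hf x y
  -- The second moment about any point is the variance plus a square.
  have hvar : wmean w (fun x => (f x - m) ^ 2) ≤ v := by
    have h1 : wmean w (fun x => (f x - f x₀) ^ 2)
        = wmean w (fun x => (f x - m) ^ 2) + (m - f x₀) ^ 2 := by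
      have : ∀ x, (f x - f x₀) ^ 2 = (f x - m) ^ 2 + (2 * (m - f x₀) * (f x - m)
          + (m - f x₀) ^ 2) := fun x => by ring
      simp_rw [this]
      rw [wmean_add, wmean_add, wmean_const hw, wmean_mul_left, wmean_sub, wmean_const hw, ← hm]
      ring
    nlinarith [sq_nonneg (m - f x₀)]
  calc wmean w (fun x => Real.exp (t * (f x - m)))
      ≤ wmean w (fun x => 1 + (t * (f x - m) + t ^ 2 * (f x - m) ^ 2)) := by
        refine wmean_mono hw.nonneg fun x => ?_
        have h1 : |t * (f x - m)| ≤ 1 := by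
          rw [abs_mul]
          exact (mul_le_mul_of_nonneg_left (hc x) (abs_nonneg t)).trans ht
        -- exp u ≤ 1 + u + u² for |u| ≤ 1; the linear term then averages to zero.
        have h2 := (abs_le.1 (Real.abs_exp_sub_one_sub_id_le h1)).2
        nlinarith
    _ = 1 + t ^ 2 * wmean w (fun x => (f x - m) ^ 2) := by
        rw [wmean_add, wmean_add, wmean_const hw, wmean_mul_left, wmean_mul_left, wmean_sub,
          wmean_const hw, ← hm]
        ring
    _ ≤ 1 + t ^ 2 * v := by gcongr
    _ ≤ Real.exp (t ^ 2 * v) := by linarith [Real.add_one_le_exp (t ^ 2 * v)]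

lemma localMGFBound_of_osc_le (hw : IsWeight w) [Nonempty Ω] {f : Ω → ℝ} {r : ℝ}
    (hf : ∀ x y, |f x - f y| ≤ r) : LocalMGFBound w f r (r ^ 2) := by
  obtain ⟨x₀⟩ := ‹Nonempty Ω›
  refine localMGFBound_of_sq_le hw hf x₀ ?_
  rw [← wmean_const hw (r ^ 2)]
  exact wmean_mono hw.nonneg fun x => sq_le_sq' (abs_le.1 (hf x x₀)).1 (abs_le.1 (hf x x₀)).2

/-- Exponential moment bounds add up along a two-step randomization. -/
lemma LocalMGFBound.combine {A B : Type*} [Fintype A] [Fintype B] {κ : A → ℝ} {ν : B → ℝ}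
    (hκ : ∀ a, 0 ≤ κ a) (φ : A → B → Ω)
    (hφ : ∀ h : Ω → ℝ, wmean w h = wmean κ (fun a => wmean ν (fun b => h (φ a b))))
    {f : Ω → ℝ} {r v₁ v₂ : ℝ} (h₁ : ∀ a, LocalMGFBound ν (fun b => f (φ a b)) r v₁)
    (h₂ : LocalMGFBound κ (fun a => wmean ν (fun b => f (φ a b))) r v₂) :
    LocalMGFBound w f r (v₁ + v₂) := by
  intro t ht
  have hm := hφ f
  set g : A → ℝ := fun a => wmean ν (fun b => f (φ a b)) with hg
  rw [hφ, hm]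
  -- The exponent splits into the deviation of the conditional mean `g a`, which does not involve
  -- `b`, and the inner deviation around `g a`.
  calc wmean κ (fun a => wmean ν (fun b => Real.exp (t * (f (φ a b) - wmean κ g))))
      = wmean κ (fun a => Real.exp (t * (g a - wmean κ g)) *
          wmean ν (fun b => Real.exp (t * (f (φ a b) - g a)))) := by
        congr 1
        ext a
        rw [← wmean_mul_left]
        congr 1
        ext b
        rw [← Real.exp_add]
        ring_nf
    _ ≤ wmean κ (fun a => Real.exp (t ^ 2 * v₁) * Real.exp (t * (g a - wmean κ g))) := by
        refine wmean_mono hκ fun a => ?_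
        rw [mul_comm]
        exact mul_le_mul_of_nonneg_right (h₁ a t ht) (Real.exp_nonneg _)
    _ ≤ Real.exp (t ^ 2 * v₁) * Real.exp (t ^ 2 * v₂) := by
        rw [wmean_mul_left]
        exact mul_le_mul_of_nonneg_left (h₂ t ht) (Real.exp_nonneg _)
    _ = Real.exp (t ^ 2 * (v₁ + v₂)) := by rw [← Real.exp_add]; ring_nf

/-- Chernoff's bound. -/
lemma LocalMGFBound.tail_le (hw : ∀ x, 0 ≤ w x) {f : Ω → ℝ} {r v : ℝ}
    (h : LocalMGFBound w f r v) {t : ℝ} (ht0 : 0 ≤ t) (ht : t * r ≤ 1) (s : ℝ)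
    [DecidablePred fun x => s < |f x - wmean w f|] :
    ∑ x with s < |f x - wmean w f|, w x ≤ 2 * Real.exp (t ^ 2 * v - t * s) := by
  have h1 := h t (by rwa [abs_of_nonneg ht0])
  have h2 := h (-t) (by rwa [abs_neg, abs_of_nonneg ht0])
  rw [neg_sq] at h2
  calc ∑ x with s < |f x - wmean w f|, w x
      ≤ ∑ x, w x * (Real.exp (-(t * s)) * (Real.exp (t * (f x - wmean w f)) +
          Real.exp (-t * (f x - wmean w f)))) := by
        rw [Finset.sum_filter]
        refine Finset.sum_le_sum fun x _ => ?_
        split_ifs with hx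
        · refine le_mul_of_one_le_right (hw x) ?_
          rw [mul_add, ← Real.exp_add, ← Real.exp_add]
          rcases lt_abs.1 hx with hx | hx
          · have : 1 ≤ Real.exp (-(t * s) + t * (f x - wmean w f)) :=
              Real.one_le_exp (by nlinarith)
            linarith [Real.exp_nonneg (-(t * s) + -t * (f x - wmean w f))]
          · have : 1 ≤ Real.exp (-(t * s) + -t * (f x - wmean w f)) :=
              Real.one_le_exp (by nlinarith)
            linarith [Real.exp_nonneg (-(t * s) + t * (f x - wmean w f))]
        · have := hw x
          positivity
    _ = Real.exp (-(t * s)) * (wmean w (fun x => Real.exp (t * (f x - wmean w f))) +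
          wmean w (fun x => Real.exp (-t * (f x - wmean w f)))) := by
        rw [← wmean_add, ← wmean_mul_left]; rfl
    _ ≤ Real.exp (-(t * s)) * (Real.exp (t ^ 2 * v) + Real.exp (t ^ 2 * v)) := by gcongr
    _ = 2 * Real.exp (t ^ 2 * v - t * s) := by
        rw [← two_mul, mul_left_comm, ← Real.exp_add]; ring_nf

end LocalMGFBound

/-! ### Concentration for independent coordinates -/

section Product

lemma isWeight_prod {ι α : Type*} [Fintype ι] [DecidableEq ι] [Fintype α] {w : ι → α → ℝ}
    (hw : ∀ i, IsWeight (w i)) : IsWeight (fun x : ι → α => ∏ i, w i (x i)) where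
  nonneg x := Finset.prod_nonneg fun i _ => (hw i).nonneg _
  sum_eq_one := by
    rw [← Fintype.prod_sum]
    exact Finset.prod_eq_one fun i _ => (hw i).sum_eq_one

lemma wmean_fin_succ {α : Type*} [Fintype α] {N : ℕ} (w : Fin (N + 1) → α → ℝ)
    (h : (Fin (N + 1) → α) → ℝ) :
    wmean (fun x : Fin (N + 1) → α => ∏ i, w i (x i)) h =
      wmean (w 0) (fun a => wmean (fun y : Fin N → α => ∏ i, w i.succ (y i))
        (fun y => h (Fin.cons a y))) := by
  simp only [wmean, Finset.mul_sum]
  rw [← Equiv.sum_comp (Fin.consEquiv fun _ => α), Fintype.sum_prod_type]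
  refine Finset.sum_congr rfl fun a _ => Finset.sum_congr rfl fun y _ => ?_
  simp [Fin.consEquiv, Fin.prod_univ_succ, mul_assoc]

/-- Exponential moment bounds add up over independent coordinates. -/
lemma localMGFBound_fin {α : Type*} [Fintype α] {r : ℝ} {N : ℕ} (w : Fin N → α → ℝ)
    (hw : ∀ i, IsWeight (w i)) (v : Fin N → ℝ)
    (hv : ∀ i, ∀ g : α → ℝ, (∀ a b, |g a - g b| ≤ r) → LocalMGFBound (w i) g r (v i))
    (f : (Fin N → α) → ℝ)
    (hf : ∀ x i a b, |f (Function.update x i a) - f (Function.update x i b)| ≤ r) :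
    LocalMGFBound (fun x : Fin N → α => ∏ i, w i (x i)) f r (∑ i, v i) := by
  induction N with
  | zero =>
    intro t _
    have : ∀ x, f x = f default := fun x => by rw [Subsingleton.elim x default]
    simp [wmean]
  | succ N ih =>
    have hs : ∑ i, v i = (∑ i : Fin N, v i.succ) + v 0 := by rw [Fin.sum_univ_succ, add_comm]
    rw [hs]
    have h₁ : ∀ a, LocalMGFBound (fun y : Fin N → α => ∏ i, w i.succ (y i))
        (fun y => f (Fin.cons (α := fun _ => α) a y)) r (∑ i : Fin N, v i.succ) := by
      intro a
      refine ih (fun i => w i.succ) (fun i => hw i.succ) (fun i => v i.succ)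
        (fun i => hv i.succ) (fun y => f (Fin.cons (α := fun _ => α) a y)) fun x i b c => ?_
      have := hf (Fin.cons a x) i.succ b c
      rwa [← Fin.cons_update, ← Fin.cons_update] at this
    refine LocalMGFBound.combine (hw 0).nonneg
      (fun a (y : Fin N → α) => Fin.cons (α := fun _ => α) a y) (wmean_fin_succ w) h₁
      (hv 0 _ fun a b => ?_)
    -- Conditional means at two values of coordinate 0 are compared with the same remaining
    -- coordinates, so they differ by at most `r`.
    rw [← wmean_sub]
    refine abs_wmean_le (isWeight_prod fun i : Fin N => hw i.succ) fun y => ?_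
    have := hf (Fin.cons a y) 0 a b
    rwa [Fin.update_cons_zero, Fin.update_cons_zero] at this

/-- Exponential moment bounds add up over independent coordinates. -/
lemma localMGFBound_pi {ι α : Type*} [Fintype ι] [DecidableEq ι] [Fintype α] {r : ℝ}
    (w : ι → α → ℝ) (hw : ∀ i, IsWeight (w i)) (v : ι → ℝ)
    (hv : ∀ i, ∀ g : α → ℝ, (∀ a b, |g a - g b| ≤ r) → LocalMGFBound (w i) g r (v i))
    (f : (ι → α) → ℝ)
    (hf : ∀ x i a b, |f (Function.update x i a) - f (Function.update x i b)| ≤ r) :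
    LocalMGFBound (fun x : ι → α => ∏ i, w i (x i)) f r (∑ i, v i) := by
  let e := Fintype.equivFin ι
  let E : (Fin (Fintype.card ι) → α) ≃ (ι → α) := Equiv.arrowCongr e.symm (Equiv.refl α)
  have hE : ∀ x j, E x j = x (e j) := fun x j => rfl
  have key := localMGFBound_fin (fun i => w (e.symm i)) (fun i => hw _) (fun i => v (e.symm i))
    (fun i => hv _) (fun x => f (E x)) (by
      intro x i a b
      have hu : ∀ c, E (Function.update x i c) = Function.update (E x) (e.symm i) c := by
        intro c
        ext j
        simp only [hE, Function.update_apply, ← Equiv.eq_symm_apply]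
      rw [hu, hu]
      exact hf _ _ _ _)
  have hm : ∀ h : (ι → α) → ℝ, wmean (fun x : ι → α => ∏ i, w i (x i)) h =
      wmean (fun x : Fin (Fintype.card ι) → α => ∏ i, w (e.symm i) (x i)) (fun x => h (E x)) := by
    intro h
    unfold wmean
    rw [← Equiv.sum_comp E]
    refine Finset.sum_congr rfl fun x _ => ?_
    congr 1
    exact (Equiv.prod_comp e.symm fun j => w j (E x j)).symm.trans (by simp [hE])
  intro t ht
  rw [hm, hm, ← Equiv.sum_comp e.symm v]
  exact key t ht

end Product

/-! ### Concentration for uniform permutations -/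

section Perm

open Equiv

lemma localMGFBound_perm_of_equiv {α β : Type*} [Fintype α] [DecidableEq α] [Fintype β]
    [DecidableEq β] (e : α ≃ β) {r v : ℝ} {f : Perm β → ℝ}
    (h : LocalMGFBound (unifWeight (Perm α)) (fun σ => f (e.permCongr σ)) r v) :
    LocalMGFBound (unifWeight (Perm β)) f r v := by
  intro t ht
  rw [wmean_unifWeight_equiv e.permCongr, wmean_unifWeight_equiv e.permCongr]
  exact h t ht

/-- A function on the symmetric group that varies by at most `c` under multiplication with
transpositions is concentrated under a uniformly random permutation. -/
lemma localMGFBound_perm {α : Type*} [Fintype α] [DecidableEq α] {c : ℝ}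
    (f : Perm α → ℝ) (hf : ∀ (σ : Perm α) (a b : α), |f (swap a b * σ) - f σ| ≤ c) :
    LocalMGFBound (unifWeight (Perm α)) f (2 * c) (Fintype.card α * (2 * c) ^ 2) := by
  classical
  suffices H : ∀ (α : Type _) [Fintype α], ∀ (_ : DecidableEq α) (f : Perm α → ℝ),
      (∀ (σ : Perm α) (a b : α), |f (swap a b * σ) - f σ| ≤ c) →
      LocalMGFBound (unifWeight (Perm α)) f (2 * c) (Fintype.card α * (2 * c) ^ 2) by
    exact H α inferInstance f hf
  clear hf f
  intro α _
  refine Fintype.induction_empty_option (P := fun α [Fintype α] => ∀ (_ : DecidableEq α)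
    (f : Perm α → ℝ), (∀ (σ : Perm α) (a b : α), |f (swap a b * σ) - f σ| ≤ c) →
      LocalMGFBound (unifWeight (Perm α)) f (2 * c) (Fintype.card α * (2 * c) ^ 2)) ?_ ?_ ?_ α
  · intro α β _ e ih _ f hf
    let := Fintype.ofEquiv β e.symm
    let : DecidableEq α := Classical.decEq α
    rw [← Fintype.card_congr e]
    have := ih inferInstance (fun σ => f (e.permCongr σ)) (by
      intro σ a b
      have h : e.permCongr (swap a b * σ) = swap (e a) (e b) * e.permCongr σ := by
        ext x
        simp only [Equiv.permCongr_apply, Perm.mul_apply]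
        exact (e.injective.map_swap _ _ _)
      rw [h]
      exact hf _ _ _)
    refine localMGFBound_perm_of_equiv e ?_
    convert this
  · intro _ f _ t _
    simp [wmean, unifWeight]
  · intro α _ ih D f hf
    let : DecidableEq α := Classical.decEq α
    obtain rfl : D = Option.instDecidableEq := Subsingleton.elim _ _
    -- A uniform permutation of `Option α` consists of a uniform image `a` of `none` and an
    -- independent uniform permutation of `α`.
    have hφ : ∀ h : Perm (Option α) → ℝ, wmean (unifWeight (Perm (Option α))) h =
        wmean (unifWeight (Option α)) (fun a => wmean (unifWeight (Perm α))
          (fun σ => h (swap none a * optionCongr σ))) := by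
      intro h
      have := fun a σ => Perm.decomposeOption_symm_apply (α := α) (a, σ)
      simp only [← this]
      rw [← wmean_unifWeight_prod (fun p => h (Perm.decomposeOption.symm p)),
        ← wmean_unifWeight_equiv]
    have hsum : (Fintype.card (Option α) : ℝ) * (2 * c) ^ 2
        = Fintype.card α * (2 * c) ^ 2 + (2 * c) ^ 2 := by
      rw [Fintype.card_option]; push_cast; ring
    rw [hsum]
    refine LocalMGFBound.combine (isWeight_unifWeight (Option α)).nonneg
      (fun a σ => swap none a * optionCongr σ) hφ (fun a => ?_) ?_
    · refine ih _ (fun σ => f (swap none a * optionCongr σ)) fun σ x y => ?_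
      -- Conjugation by `swap none a` turns a transposition acting on `σ` into one acting on the
      -- whole permutation.
      have h : swap none a * optionCongr (swap x y * σ) =
          swap (swap none a (some x)) (swap none a (some y)) *
            (swap none a * optionCongr σ) := by
        have h1 : optionCongr (swap x y * σ) = optionCongr (swap x y) * optionCongr σ :=
          (optionCongr_trans σ (swap x y))
        rw [h1, optionCongr_swap, ← mul_assoc, ← mul_assoc, Equiv.mul_swap_eq_swap_mul]
      rw [h]
      exact hf _ _ _
    -- Changing `a` removes one transposition and inserts another, hence the oscillation `2 * c`.
    · refine localMGFBound_of_osc_le (isWeight_unifWeight _) fun a b => ?_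
      rw [← wmean_sub]
      refine abs_wmean_le (isWeight_unifWeight _) fun σ => ?_
      have h1 := hf (optionCongr σ) none a
      have h2 := hf (optionCongr σ) none b
      rw [abs_le] at *
      constructor <;> linarith

end Perm

/-! ### Lipschitz dependence of log Z on the edges -/

section PartitionFunction

variable {V : Type*} {q : ℕ} {β : ℝ}

lemma exp_neg_le_edgeWeight (hβ : 0 ≤ β) (σ : V → Fin q) (e : Sym2 V) :
    Real.exp (-β) ≤ edgeWeight β σ e := by
  have : Real.exp (-β) ≤ 1 := Real.exp_le_one_iff.2 (by linarith)
  unfold edgeWeight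
  split_ifs <;> linarith

lemma edgeWeight_le_one (hβ : 0 ≤ β) (σ : V → Fin q) (e : Sym2 V) : edgeWeight β σ e ≤ 1 := by
  have : Real.exp (-β) ≤ 1 := Real.exp_le_one_iff.2 (by linarith)
  unfold edgeWeight
  split_ifs <;> linarith

lemma prod_edgeWeight_pos (hβ : 0 ≤ β) (σ : V → Fin q) (S : Multiset (Sym2 V)) :
    0 < (S.map (edgeWeight β σ)).prod := by
  refine Multiset.prod_induction (fun x => 0 < x) _ (fun _ _ => mul_pos) one_pos fun x hx => ?_
  obtain ⟨e, _, rfl⟩ := Multiset.mem_map.1 hx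
  exact (Real.exp_pos _).trans_le (exp_neg_le_edgeWeight hβ σ e)

lemma prod_edgeWeight_le_one (hβ : 0 ≤ β) (σ : V → Fin q) (S : Multiset (Sym2 V)) :
    (S.map (edgeWeight β σ)).prod ≤ 1 := by
  induction S using Multiset.induction_on with
  | empty => simp
  | cons e S ih =>
    rw [Multiset.map_cons, Multiset.prod_cons]
    exact mul_le_one₀ (edgeWeight_le_one hβ σ e) (prod_edgeWeight_pos hβ σ S).le ih

lemma exp_neg_pow_le_prod_edgeWeight (hβ : 0 ≤ β) (σ : V → Fin q) (S : Multiset (Sym2 V)) :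
    Real.exp (-β) ^ S.card ≤ (S.map (edgeWeight β σ)).prod := by
  induction S using Multiset.induction_on with
  | empty => simp
  | cons e S ih =>
    rw [Multiset.map_cons, Multiset.prod_cons, Multiset.card_cons, pow_succ']
    exact mul_le_mul (exp_neg_le_edgeWeight hβ σ e) ih (by positivity)
      ((Real.exp_pos _).trans_le (exp_neg_le_edgeWeight hβ σ e)).le

variable [Fintype V]

lemma partitionFunction_pos (hq : 1 ≤ q) (hβ : 0 ≤ β) (G : Multigraph V) :
    0 < G.partitionFunction q β := by
  have : Nonempty (Fin q) := ⟨⟨0, hq⟩⟩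
  unfold Multigraph.partitionFunction
  classical
  exact Finset.sum_pos (fun σ _ => prod_edgeWeight_pos hβ σ _) ⟨Classical.arbitrary _, Finset.mem_univ _⟩

/-- Weights are at most 1, so further edges can only shrink each summand of Z. -/
lemma logZ_add_le (hq : 1 ≤ q) (hβ : 0 ≤ β) (S A : Multiset (Sym2 V)) :
    (⟨S + A⟩ : Multigraph V).logZ q β ≤ (⟨S⟩ : Multigraph V).logZ q β := by
  refine Real.log_le_log (partitionFunction_pos hq hβ _) (Finset.sum_le_sum fun σ _ => ?_)
  rw [Multiset.map_add, Multiset.prod_add]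
  exact mul_le_of_le_one_right (prod_edgeWeight_pos hβ σ S).le (prod_edgeWeight_le_one hβ σ A)

/-- Each further edge costs every summand of Z a factor no smaller than e^{-β}. -/
lemma logZ_sub_le_logZ_add (hq : 1 ≤ q) (hβ : 0 ≤ β) (S A : Multiset (Sym2 V)) :
    (⟨S⟩ : Multigraph V).logZ q β - β * A.card ≤ (⟨S + A⟩ : Multigraph V).logZ q β := by
  have h : Real.exp (-β) ^ A.card * (⟨S⟩ : Multigraph V).partitionFunction q β ≤
      (⟨S + A⟩ : Multigraph V).partitionFunction q β := by
    unfold Multigraph.partitionFunction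
    rw [Finset.mul_sum]
    refine Finset.sum_le_sum fun σ _ => ?_
    rw [Multiset.map_add, Multiset.prod_add, mul_comm]
    exact mul_le_mul_of_nonneg_left (exp_neg_pow_le_prod_edgeWeight hβ σ A)
      (prod_edgeWeight_pos hβ σ S).le
  have hS := partitionFunction_pos hq hβ (⟨S⟩ : Multigraph V)
  have := Real.log_le_log (by positivity) h
  rw [Real.log_mul (by positivity) hS.ne', Real.log_pow, Real.log_exp] at this
  unfold Multigraph.logZ
  linarith

lemma abs_logZ_add_sub_le (hq : 1 ≤ q) (hβ : 0 ≤ β) (S A : Multiset (Sym2 V)) :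
    |(⟨S + A⟩ : Multigraph V).logZ q β - (⟨S⟩ : Multigraph V).logZ q β| ≤ β * A.card := by
  have h1 := logZ_add_le hq hβ S A
  have h2 := logZ_sub_le_logZ_add hq hβ S A
  have : 0 ≤ β * A.card := by positivity
  rw [abs_le]
  constructor <;> linarith

/-- Replacing at most `k` edges changes `log Z` by at most `β k`. -/
lemma abs_logZ_add_sub_logZ_add_le (hq : 1 ≤ q) (hβ : 0 ≤ β) (S A B : Multiset (Sym2 V)) {k : ℕ}
    (hA : A.card ≤ k) (hB : B.card ≤ k) :
    |(⟨S + A⟩ : Multigraph V).logZ q β - (⟨S + B⟩ : Multigraph V).logZ q β| ≤ β * k := by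
  -- Both values lie in the interval of length `β * k` that ends at the value for `S`; this avoids a
  -- factor 2.
  have h1 := logZ_add_le hq hβ S A
  have h2 := logZ_sub_le_logZ_add hq hβ S A
  have h3 := logZ_add_le hq hβ S B
  have h4 := logZ_sub_le_logZ_add hq hβ S B
  have h5 : β * A.card ≤ β * k := by gcongr
  have h6 : β * B.card ≤ β * k := by gcongr
  rw [abs_le]
  constructor <;> linarith

/-- Indexing both edge multisets by the same `T` isolates their common part. This is the form used
when a coordinate or a transposition moves only a few edges. -/
lemma abs_logZ_map_sub_le (hq : 1 ≤ q) (hβ : 0 ≤ β) {E : Type*} (T : Multiset E)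
    (φ ψ : E → Sym2 V) [DecidablePred fun e => φ e ≠ ψ e] {k : ℕ}
    (hk : (T.filter fun e => φ e ≠ ψ e).card ≤ k) :
    |(⟨T.map φ⟩ : Multigraph V).logZ q β - (⟨T.map ψ⟩ : Multigraph V).logZ q β| ≤ β * k := by
  have h : ∀ χ : E → Sym2 V, T.map χ =
      (T.filter fun e => ¬ φ e ≠ ψ e).map χ + (T.filter fun e => φ e ≠ ψ e).map χ := by
    intro χ
    rw [← Multiset.map_add, add_comm, Multiset.filter_add_not]
  rw [h φ, h ψ]
  have hc : (T.filter fun e => ¬ φ e ≠ ψ e).map φ = (T.filter fun e => ¬ φ e ≠ ψ e).map ψ :=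
    Multiset.map_congr rfl fun e he => not_not.1 (Multiset.mem_filter.1 he).2
  rw [hc]
  exact abs_logZ_add_sub_logZ_add_le hq hβ _ _ _ (by simpa using hk) (by simpa using hk)

/-- The a priori bound behind recentring: with O(n) edges, log Z stays within O(n) of its value on
the edgeless graph. -/
lemma abs_logZ_sub_logZ_empty_le (hq : 1 ≤ q) (hβ : 0 ≤ β) (G : Multigraph V) :
    |G.logZ q β - (⟨0⟩ : Multigraph V).logZ q β| ≤ β * G.edges.card := by
  simpa using abs_logZ_add_sub_le hq hβ 0 G.edges

end PartitionFunction

/-! ### Exponential rates and recentring -/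

section Rates

/-- Near-optimal choice of `t` in the Chernoff exponent. With variance `v * n` and deviation `s * n`
the exponent is at most `-(t * s / 2) * n`, and `t` does not depend on `n`. The added ones keep the
denominators positive. -/
lemma exists_chernoff_parameter {r v s : ℝ} (hr : 0 ≤ r) (hv : 0 ≤ v) (hs : 0 < s) :
    ∃ t : ℝ, 0 < t ∧ t * r ≤ 1 ∧ t ^ 2 * v - t * s ≤ -(t * s / 2) := by
  refine ⟨min (1 / (r + 1)) (s / (2 * (v + 1))), by positivity, ?_, ?_⟩
  · calc min (1 / (r + 1)) (s / (2 * (v + 1))) * r ≤ 1 / (r + 1) * r := by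
          gcongr; exact min_le_left _ _
      _ ≤ 1 := by rw [div_mul_eq_mul_div, div_le_one (by positivity)]; linarith
  · set t := min (1 / (r + 1)) (s / (2 * (v + 1))) with ht
    have ht0 : 0 < t := by positivity
    have h : t * v ≤ s / 2 := by
      calc t * v ≤ s / (2 * (v + 1)) * v := by gcongr; exact min_le_right _ _
        _ ≤ s / 2 := by
          rw [div_mul_eq_mul_div, div_le_div_iff₀ (by positivity) (by positivity)]
          nlinarith
    nlinarith

/-- Polynomial factors are absorbed by an exponential rate. -/
lemma eventually_mul_exp_le (K : ℝ) (k : ℕ) {c : ℝ} (hc : 0 < c) :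
    ∀ᶠ n : ℕ in atTop, K * (n : ℝ) ^ k * Real.exp (-c * n) ≤ Real.exp (-(c / 2) * n) := by
  have h1 : Tendsto (fun n : ℕ => K * ((n : ℝ) ^ k * Real.exp (-(c / 2) * n))) atTop (nhds 0) := by
    have := (Real.tendsto_pow_mul_exp_neg_atTop_nhds_zero k).comp
      (tendsto_natCast_atTop_atTop.const_mul_atTop (half_pos hc))
    have := this.const_mul (K * ((c / 2) ^ k)⁻¹)
    rw [mul_zero] at this
    refine this.congr fun n => ?_
    have hck : (c / 2) ^ k ≠ 0 := by positivity
    simp only [Function.comp_apply, mul_pow, neg_mul]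
    field_simp
  filter_upwards [h1.eventually (gt_mem_nhds one_pos)] with n hn
  have : Real.exp (-c * n) = Real.exp (-(c / 2) * n) * Real.exp (-(c / 2) * n) := by
    rw [← Real.exp_add]; ring_nf
  rw [this]
  nlinarith [Real.exp_pos (-(c / 2) * n)]

lemma eventually_const_mul_exp_le (K : ℝ) {c : ℝ} (hc : 0 < c) :
    ∀ᶠ n : ℕ in atTop, K * Real.exp (-c * n) ≤ Real.exp (-(c / 2) * n) := by
  simpa using eventually_mul_exp_le K 0 hc

/-- Concentration around any centre implies concentration around the mean, for random variables
at bounded linear distance from the centre. -/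
lemma exists_rate_deviationProb {Ω : ℕ → Type*} [∀ n, MeasurableSpace (Ω n)]
    (μ : ∀ n, Measure (Ω n)) (X : ∀ n, Ω n → ℝ) (hX : ∀ n, Measurable (X n)) (a : ℕ → ℝ) (C : ℝ)
    (P : ℕ → Prop) (hP : ∀ᶠ n in atTop, P n → IsProbabilityMeasure (μ n) ∧
      ∀ᵐ ω ∂μ n, |X n ω - a n| ≤ C * n)
    (hc : ∀ s : ℝ, 0 < s → ∃ c : ℝ, 0 < c ∧ ∀ᶠ n : ℕ in atTop, P n →
      (μ n).real {ω | s * n < |X n ω - a n|} ≤ Real.exp (-c * n)) {δ : ℝ} (hδ : 0 < δ) :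
    ∃ ξ : ℝ, 0 < ξ ∧ ∀ᶠ n : ℕ in atTop, P n →
      deviationProb (μ n) (X n) (δ * n) ≤ Real.exp (-ξ * n) := by
  -- Off an exponentially unlikely event, `X` is within `δ / 4 * n` of the centre, and on that event
  -- within `|C| * n`. So the mean is within `δ / 2 * n` of the centre, and a deviation `δ * n` from
  -- the mean leaves more than `δ / 4 * n` from the centre.
  obtain ⟨c, hc0, hc⟩ := hc (δ / 4) (by positivity)
  refine ⟨c, hc0, ?_⟩
  have hlim := eventually_const_mul_exp_le (|C| * (4 / δ)) hc0
  filter_upwards [hP, hc, hlim] with n hPn hcn hln hn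
  obtain ⟨_, hb⟩ := hPn hn
  specialize hcn hn
  have hS : MeasurableSet {ω | δ / 4 * n < |X n ω - a n|} :=
    measurableSet_lt measurable_const ((hX n).sub_const _).abs
  have hsmall : |C| * n * Real.exp (-c * n) ≤ δ / 4 * n := by
    have h1 : Real.exp (-(c / 2) * n) ≤ 1 :=
      Real.exp_le_one_iff.2 (by nlinarith [(Nat.cast_nonneg n : (0 : ℝ) ≤ n)])
    have h2 : |C| * Real.exp (-c * n) ≤ δ / 4 := by
      have h3 := hln.trans h1
      have h4 : |C| * (4 / δ) * Real.exp (-c * n) = (|C| * Real.exp (-c * n)) / (δ / 4) := by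
        field_simp
      rw [h4, div_le_one (by positivity)] at h3
      exact h3
    nlinarith [(Nat.cast_nonneg n : (0 : ℝ) ≤ n)]
  have hint : Integrable (fun ω => X n ω - a n) (μ n) :=
    Integrable.of_bound ((hX n).sub_const _).aestronglyMeasurable (C * n) hb
  have hmean : |∫ ω, X n ω ∂μ n - a n| ≤ δ / 2 * n := by
    have hXint : Integrable (X n) (μ n) := by
      exact (hint.add (integrable_const (a n))).congr (ae_of_all _ fun ω => by simp)
    have h1 : ∫ ω, X n ω ∂μ n - a n = ∫ ω, (X n ω - a n) ∂μ n := by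
      rw [integral_sub hXint (integrable_const _)]; simp
    rw [h1]
    calc |∫ ω, (X n ω - a n) ∂μ n| ≤ ∫ ω, |X n ω - a n| ∂μ n := abs_integral_le_integral_abs
      _ ≤ ∫ ω, (δ / 4 * n + {ω | δ / 4 * n < |X n ω - a n|}.indicator
            (fun _ => |C| * n) ω) ∂μ n := by
          refine integral_mono_ae hint.abs
            ((integrable_const _).add ((integrable_const _).indicator hS)) ?_
          filter_upwards [hb] with ω hω
          by_cases h : δ / 4 * n < |X n ω - a n|
          · rw [Set.indicator_of_mem (by exact h)]
            have : C * n ≤ |C| * n := by gcongr; exact le_abs_self C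
            have : 0 ≤ δ / 4 * n := by positivity
            linarith
          · rw [Set.indicator_of_notMem (by exact h)]
            linarith
      _ = δ / 4 * n + (μ n).real {ω | δ / 4 * n < |X n ω - a n|} * (|C| * n) := by
          rw [integral_add (integrable_const _) ((integrable_const _).indicator hS),
            integral_indicator_const _ hS]
          simp
      _ ≤ δ / 4 * n + Real.exp (-c * n) * (|C| * n) := by gcongr
      _ ≤ δ / 2 * n := by linarith
  refine le_trans (measureReal_mono fun ω hω => ?_) hcn
  simp only [Set.mem_ofPred_eq, gt_iff_lt] at hω ⊢
  have h1 : |X n ω - ∫ ω', X n ω' ∂μ n| ≤ |X n ω - a n| + |∫ ω, X n ω ∂μ n - a n| := by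
    have : X n ω - ∫ ω', X n ω' ∂μ n = (X n ω - a n) - (∫ ω, X n ω ∂μ n - a n) := by ring
    rw [this]
    exact abs_sub _ _
  have : 0 ≤ δ / 4 * n := by positivity
  linarith

end Rates

/-! ### From measures to weighted means -/

section Transfer

/-- Chernoff's bound for a law whose expectations are weighted means. -/
lemma LocalMGFBound.measureReal_le {Ω T : Type*} [MeasurableSpace Ω] [Fintype T] {μ : Measure Ω}
    {w : T → ℝ} (hw : ∀ x, 0 ≤ w x) (h : T → Ω)
    (hμ : ∀ F : Ω → ℝ, Measurable F → ∫ ω, F ω ∂μ = wmean w (fun x => F (h x))) {X : Ω → ℝ}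
    (hX : Measurable X) {r v : ℝ} (hb : LocalMGFBound w (fun x => X (h x)) r v) {t : ℝ}
    (ht0 : 0 ≤ t) (ht : t * r ≤ 1) (s : ℝ) :
    μ.real {ω | s < |X ω - ∫ ω', X ω' ∂μ|} ≤ 2 * Real.exp (t ^ 2 * v - t * s) := by
  classical
  have hS : MeasurableSet {ω | s < |X ω - ∫ ω', X ω' ∂μ|} :=
    measurableSet_lt measurable_const (hX.sub_const _).abs
  rw [← integral_indicator_one hS, hμ _ (measurable_one.indicator hS)]
  refine le_trans (le_of_eq ?_) (hb.tail_le hw ht0 ht s)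
  rw [Finset.sum_filter, hμ X hX, wmean]
  refine Finset.sum_congr rfl fun x _ => ?_
  simp [Set.indicator_apply]

variable {α Ω : Type*} [MeasurableSpace Ω] (s : Finset α) (f : α → Ω)

lemma integral_uniformLaw {F : Ω → ℝ} (hF : Measurable F) :
    ∫ ω, F ω ∂uniformLaw s f = (s.card : ℝ)⁻¹ * ∑ a ∈ s, F (f a) := by
  rw [uniformLaw, integral_smul_measure, integral_finsetSum_measure fun a _ =>
    (integrable_dirac' hF.stronglyMeasurable (by simp))]
  simp [integral_dirac' _ _ hF.stronglyMeasurable]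

lemma isProbabilityMeasure_uniformLaw (hs : s.Nonempty) :
    IsProbabilityMeasure (uniformLaw s f) := by
  constructor
  simp only [uniformLaw, Measure.smul_apply, Measure.coe_finsetSum, Finset.sum_apply,
    measure_univ, Finset.sum_const, nsmul_eq_mul, mul_one, smul_eq_mul]
  exact ENNReal.inv_mul_cancel (by simpa using hs.ne_empty) (by simp)

lemma ae_uniformLaw {p : Ω → Prop} (hp : MeasurableSet {ω | p ω}) (h : ∀ a ∈ s, p (f a)) :
    ∀ᵐ ω ∂uniformLaw s f, p ω := by
  rw [ae_iff]
  have hp' : MeasurableSet {ω | ¬ p ω} := hp.compl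
  simp only [uniformLaw, Measure.smul_apply, Measure.coe_finsetSum, Finset.sum_apply, smul_eq_mul]
  rw [Finset.sum_eq_zero, mul_zero]
  intro a ha
  rw [Measure.dirac_apply' _ hp']
  simp [h a ha]

end Transfer

/-! ### Poisson tails -/

section Poisson

open NNReal

lemma hasSum_exp_mul_poisson (r : ℝ≥0) (t : ℝ) :
    HasSum (fun n : ℕ => Real.exp (-r) * r ^ n / n.factorial * Real.exp (t * n))
      (Real.exp (r * (Real.exp t - 1))) := by
  have h := (NormedSpace.expSeries_div_hasSum_exp (r * Real.exp t : ℝ)).mul_left (Real.exp (-r))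
  rw [← Real.exp_eq_exp_ℝ, ← Real.exp_add] at h
  have e : (r : ℝ) * (Real.exp t - 1) = -r + r * Real.exp t := by ring
  rw [e]
  refine h.congr_fun fun n => ?_
  rw [mul_pow, ← Real.exp_nat_mul, mul_comm t]
  ring

lemma integrable_exp_mul_poissonMeasure (r : ℝ≥0) (t : ℝ) :
    Integrable (fun n : ℕ => Real.exp (t * n)) (poissonMeasure r) := by
  rw [integrable_poissonMeasure_iff]
  simpa using (hasSum_exp_mul_poisson r t).summable

lemma mgf_poissonMeasure (r : ℝ≥0) (t : ℝ) :
    mgf (fun n : ℕ => (n : ℝ)) (poissonMeasure r) t = Real.exp (r * (Real.exp t - 1)) := by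
  rw [mgf, integral_poissonMeasure, ← (hasSum_exp_mul_poisson r t).tsum_eq]
  simp

/-- Chernoff's bound for the Poisson distribution. -/
lemma poissonMeasure_tail_le (r : ℝ≥0) {t : ℝ} (ht0 : 0 ≤ t) (ht : t ≤ 1) (s : ℝ) :
    (poissonMeasure r).real {m : ℕ | s < |(m : ℝ) - r|} ≤ 2 * Real.exp (t ^ 2 * r - t * s) := by
  -- exp u - 1 ≤ u + u²; `u = t` serves the upper tail and `u = -t` the lower one.
  have key : ∀ u : ℝ, |u| ≤ 1 → u ^ 2 = t ^ 2 → Real.exp (r * (Real.exp u - 1))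
      ≤ Real.exp (t ^ 2 * r + u * r) := by
    intro u hu hut
    refine Real.exp_le_exp.2 ?_
    have := (abs_le.1 (Real.abs_exp_sub_one_sub_id_le hu)).2
    rw [hut] at this
    nlinarith [r.coe_nonneg]
  have habs : |t| ≤ 1 := by rwa [abs_of_nonneg ht0]
  have h1 := measure_ge_le_exp_mul_mgf (μ := poissonMeasure r) (X := fun n : ℕ => (n : ℝ))
    (r + s) ht0 (integrable_exp_mul_poissonMeasure r t)
  have h2 := measure_le_le_exp_mul_mgf (μ := poissonMeasure r) (X := fun n : ℕ => (n : ℝ))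
    (r - s) (neg_nonpos.2 ht0) (integrable_exp_mul_poissonMeasure r (-t))
  rw [mgf_poissonMeasure] at h1 h2
  have h3 := mul_le_mul_of_nonneg_left (key t habs rfl) (Real.exp_nonneg (-t * (r + s)))
  have h4 := mul_le_mul_of_nonneg_left (key (-t) (by rwa [abs_neg]) (neg_sq t))
    (Real.exp_nonneg (- -t * (r - s)))
  rw [← Real.exp_add (-t * (r + s)) (t ^ 2 * r + t * r)] at h3
  rw [← Real.exp_add (- -t * (r - s)) (t ^ 2 * r + -t * r)] at h4
  have e1 : -t * (r + s) + (t ^ 2 * r + t * r) = t ^ 2 * r - t * s := by ring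
  have e2 : - -t * (r - s) + (t ^ 2 * r + -t * r) = t ^ 2 * r - t * s := by ring
  rw [e1] at h3
  rw [e2] at h4
  calc (poissonMeasure r).real {m : ℕ | s < |(m : ℝ) - r|}
      ≤ (poissonMeasure r).real ({m : ℕ | (r : ℝ) + s ≤ m} ∪ {m : ℕ | (m : ℝ) ≤ r - s}) := by
        refine measureReal_mono fun m hm => ?_
        simp only [Set.mem_ofPred_eq, Set.mem_union] at hm ⊢
        rcases lt_abs.1 hm with h | h
        · left; linarith
        · right; linarith
    _ ≤ _ := measureReal_union_le _ _
    _ ≤ _ := by linarith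

end Poisson

/-! ### The conditioned number of edges -/

section EdgeNumber

variable {ε d : ℝ}

/-- The mean number of edges of the unconditioned Poisson variable. -/
noncomputable def meanEdges (ε d : ℝ) (n : ℕ) : ℝ := (1 - ε) * d * n / 2

lemma meanEdges_nonneg (hε1 : ε ≤ 1) (hd : 0 < d) (n : ℕ) : 0 ≤ meanEdges ε d n := by
  have : 0 ≤ 1 - ε := by linarith
  unfold meanEdges
  positivity

lemma meanEdges_le (hε : 0 < ε) (hd : 0 < d) (n : ℕ) : meanEdges ε d n ≤ d * n / 2 := by
  unfold meanEdges
  have : 0 ≤ ε * (d * n) := by positivity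
  nlinarith

lemma exists_rate_poisson (hε : 0 < ε) (hε1 : ε ≤ 1) (hd : 0 < d) {s : ℝ} (hs : 0 < s) :
    ∃ c : ℝ, 0 < c ∧ ∀ᶠ n : ℕ in atTop,
      (poissonMeasure ((1 - ε) * d * n / 2).toNNReal).real
        {m : ℕ | s * n < |(m : ℝ) - meanEdges ε d n|} ≤ Real.exp (-c * n) := by
  obtain ⟨t, ht0, ht1, hts⟩ := exists_chernoff_parameter (r := 1) (v := d / 2) (s := s)
    zero_le_one (by positivity) hs
  rw [mul_one] at ht1
  refine ⟨t * s / 2 / 2, by positivity, ?_⟩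
  filter_upwards [eventually_const_mul_exp_le 2 (c := t * s / 2) (by positivity)] with n hn
  have h := poissonMeasure_tail_le (meanEdges ε d n).toNNReal ht0.le ht1 (s * n)
  rw [Real.coe_toNNReal _ (meanEdges_nonneg hε1 hd n)] at h
  refine h.trans (le_trans ?_ hn)
  gcongr
  have h1 := mul_le_mul_of_nonneg_left (meanEdges_le hε hd n) (sq_nonneg t)
  have h2 : (0 : ℝ) ≤ n := n.cast_nonneg
  nlinarith

/-- The Poisson mean lies below the truncation point by `ε * d / 2 * n`, so exceeding the latter is
a large deviation. -/
lemma half_le_poissonMeasure (hε : 0 < ε) (hε1 : ε ≤ 1) (hd : 0 < d) :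
    ∀ᶠ n : ℕ in atTop, 1 / 2 ≤ (poissonMeasure ((1 - ε) * d * n / 2).toNNReal).real
      {m : ℕ | (m : ℝ) ≤ d * n / 2} := by
  obtain ⟨c, hc, h⟩ := exists_rate_poisson hε hε1 hd (s := ε * d / 2) (by positivity)
  have h2 : Tendsto (fun n : ℕ => Real.exp (-c * n)) atTop (nhds 0) := by
    refine Real.tendsto_exp_atBot.comp ?_
    exact tendsto_natCast_atTop_atTop.const_mul_atTop_of_neg (by linarith)
  filter_upwards [h, h2.eventually (gt_mem_nhds (show (0 : ℝ) < 1 / 2 by norm_num))] with n hn hn2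
  have hcompl : {m : ℕ | (m : ℝ) ≤ d * n / 2}ᶜ ⊆
      {m : ℕ | ε * d / 2 * n < |(m : ℝ) - meanEdges ε d n|} := by
    intro m hm
    simp only [Set.mem_compl_iff, Set.mem_ofPred_eq, not_le] at hm ⊢
    refine lt_of_lt_of_le ?_ (le_abs_self _)
    unfold meanEdges
    linarith
  have h3 := measureReal_mono (μ := poissonMeasure ((1 - ε) * d * n / 2).toNNReal) hcompl
  have h4 := probReal_compl_eq_one_sub (μ := poissonMeasure ((1 - ε) * d * n / 2).toNNReal)
    (s := {m : ℕ | (m : ℝ) ≤ d * n / 2}) .of_discrete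
  linarith

/-- Conditioning on an event of probability at least 1/2 at most doubles probabilities, so Poisson
tails carry over. -/
lemma eventually_edgeNumber (hε : 0 < ε) (hε1 : ε ≤ 1) (hd : 0 < d) :
    ∀ᶠ n : ℕ in atTop, IsProbabilityMeasure (edgeNumber ε d n) ∧
      (∀ᵐ m : ℕ ∂edgeNumber ε d n, (m : ℝ) ≤ d * n / 2) ∧
      ∀ A : Set ℕ, (edgeNumber ε d n).real A ≤
        2 * (poissonMeasure ((1 - ε) * d * n / 2).toNNReal).real A := by
  filter_upwards [half_le_poissonMeasure hε hε1 hd] with n hn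
  refine ⟨?_, ?_, fun A => ?_⟩
  · have h0 : ∀ (μ : Measure ℕ) (S : Set ℕ), 1 / 2 ≤ μ.real S → μ S ≠ 0 := by
      intro μ S hS h
      rw [measureReal_def, h] at hS
      norm_num at hS
    exact cond_isProbabilityMeasure (h0 _ _ hn)
  · exact ae_cond_mem .of_discrete
  · rw [edgeNumber, measureReal_def, cond_apply .of_discrete, ENNReal.toReal_mul,
      ENNReal.toReal_inv, ← measureReal_def, ← measureReal_def]
    have h1 : ((poissonMeasure ((1 - ε) * d * n / 2).toNNReal).real
        {m : ℕ | (m : ℝ) ≤ d * n / 2})⁻¹ ≤ 2 := by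
      rw [inv_le_comm₀ (by linarith) (by norm_num)]
      linarith
    refine mul_le_mul h1 (measureReal_mono Set.inter_subset_right) measureReal_nonneg (by norm_num)

lemma exists_rate_edgeNumber (hε : 0 < ε) (hε1 : ε ≤ 1) (hd : 0 < d) {s : ℝ} (hs : 0 < s) :
    ∃ c : ℝ, 0 < c ∧ ∀ᶠ n : ℕ in atTop,
      (edgeNumber ε d n).real {m : ℕ | s * n < |(m : ℝ) - meanEdges ε d n|}
        ≤ Real.exp (-c * n) := by
  obtain ⟨c, hc, h⟩ := exists_rate_poisson hε hε1 hd hs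
  refine ⟨c / 2, by positivity, ?_⟩
  filter_upwards [h, eventually_edgeNumber hε hε1 hd, eventually_const_mul_exp_le 2 hc]
    with n h1 h2 h3
  linarith [h2.2.2 {m : ℕ | s * n < |(m : ℝ) - meanEdges ε d n|}]

end EdgeNumber

/-! ### Randomizing the number of edges -/

section Mixture

lemma measurable_logZ {V : Type*} [Fintype V] (q : ℕ) (β : ℝ) :
    Measurable (Multigraph.logZ (V := V) q β) := .of_discrete

lemma abs_integral_logZ_sub_le {V : Type*} [Fintype V] {q : ℕ} (hq : 1 ≤ q) {β : ℝ} (hβ : 0 ≤ β)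
    {κ : Measure (Multigraph V)} [IsProbabilityMeasure κ] {m : ℕ}
    (hm : ∀ᵐ G ∂κ, G.edges.card = m) :
    |∫ G, G.logZ q β ∂κ - (⟨0⟩ : Multigraph V).logZ q β| ≤ β * m := by
  set b := (⟨0⟩ : Multigraph V).logZ q β
  have hb : ∀ᵐ G ∂κ, ‖G.logZ q β - b‖ ≤ β * m := by
    filter_upwards [hm] with G hG
    rw [← hG]
    exact abs_logZ_sub_logZ_empty_le hq hβ G
  have hint : Integrable (fun G : Multigraph V => G.logZ q β - b) κ :=
    Integrable.of_bound ((measurable_logZ q β).sub_const _).aestronglyMeasurable _ hb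
  have hint' : Integrable (fun G : Multigraph V => G.logZ q β) κ :=
    (hint.add (integrable_const b)).congr (ae_of_all _ fun ω => by simp)
  have h1 : ∫ G, G.logZ q β ∂κ - b = ∫ G, (G.logZ q β - b) ∂κ := by
    rw [integral_sub hint' (integrable_const _)]; simp
  rw [h1, ← Real.norm_eq_abs]
  simpa using norm_integral_le_of_norm_le_const hb

/-- Telescoping. Increments are controlled only up to `x`, because a matching cannot use more than
all clones. -/
lemma abs_sub_le_mul_of_abs_succ_sub_le {g : ℕ → ℝ} {L x : ℝ}
    (hg : ∀ m : ℕ, ((m + 1 : ℕ) : ℝ) ≤ x → |g (m + 1) - g m| ≤ L) {a b : ℕ}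
    (ha : (a : ℝ) ≤ x) (hb : (b : ℝ) ≤ x) : |g a - g b| ≤ L * |(a : ℝ) - b| := by
  wlog hab : b ≤ a generalizing a b
  · rw [abs_sub_comm, abs_sub_comm (a : ℝ)]
    exact this hb ha (le_of_not_ge hab)
  induction a, hab using Nat.le_induction with
  | base => simp
  | succ k hk ih =>
    have hk' : (k : ℝ) ≤ x := by push_cast at ha; linarith
    have h1 := ih hk'
    have h2 := hg k ha
    have h3 : (b : ℝ) ≤ k := by exact_mod_cast hk
    rw [abs_of_nonneg (a := (k : ℝ) - b) (by linarith)] at h1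
    rw [abs_of_nonneg (a := ((k + 1 : ℕ) : ℝ) - b) (by push_cast; linarith)]
    calc |g (k + 1) - g b| = |(g (k + 1) - g k) + (g k - g b)| := by ring_nf
      _ ≤ |g (k + 1) - g k| + |g k - g b| := abs_add_le _ _
      _ ≤ L * (((k + 1 : ℕ) : ℝ) - b) := by push_cast; linarith

/-- `log Z` concentrates on a random multigraph with a random number of edges as soon as it
concentrates for any given number of edges, with a mean that varies slowly with this number. -/
lemma exists_rate_mixture {q : ℕ} (hq : 1 ≤ q) {ε δ β d : ℝ} (hε : 0 < ε) (hε1 : ε ≤ 1)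
    (hδ : 0 < δ) (hβ : 0 < β) (hd : 0 < d) (κ : ∀ n, ℕ → Measure (Multigraph (Fin n)))
    (hprob : ∀ᶠ n : ℕ in atTop, ∀ m : ℕ, (m : ℝ) ≤ d * n / 2 →
      IsProbabilityMeasure (κ n m) ∧ ∀ᵐ G ∂κ n m, G.edges.card = m)
    (hlip : ∀ᶠ n : ℕ in atTop, ∀ m : ℕ, ((m + 1 : ℕ) : ℝ) ≤ d * n / 2 →
      |∫ G, G.logZ q β ∂κ n (m + 1) - ∫ G, G.logZ q β ∂κ n m| ≤ β)
    (hconc : ∀ s : ℝ, 0 < s → ∃ c : ℝ, 0 < c ∧ ∀ᶠ n : ℕ in atTop, ∀ m : ℕ,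
      (m : ℝ) ≤ d * n / 2 → (κ n m).real {G | s * n < |G.logZ q β - ∫ G, G.logZ q β ∂κ n m|}
        ≤ Real.exp (-c * n)) :
    ∃ ξ : ℝ, 0 < ξ ∧ ∀ᶠ n : ℕ in atTop,
      deviationProb ((edgeNumber ε d n).bind (κ n)) (fun G => G.logZ q β) (δ * n)
        ≤ Real.exp (-ξ * n) := by
  -- The mean of log Z given this typical number of edges serves as the centre.
  set m₀ : ℕ → ℕ := fun n => ⌊meanEdges ε d n⌋₊ with hm₀
  have hm₀le : ∀ n, (m₀ n : ℝ) ≤ meanEdges ε d n := fun n =>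
    Nat.floor_le (meanEdges_nonneg hε1 hd n)
  have hm₀le' : ∀ n, (m₀ n : ℝ) ≤ d * n / 2 := fun n =>
    (hm₀le n).trans (meanEdges_le hε hd n)
  have hae : ∀ n, ∀ p : Multigraph (Fin n) → Prop,
      (∀ᵐ m ∂edgeNumber ε d n, ∀ᵐ G ∂κ n m, p G) →
      ∀ᵐ G ∂(edgeNumber ε d n).bind (κ n), p G := by
    intro n p h
    rw [ae_iff, Measure.bind_apply .of_discrete (Measurable.of_discrete).aemeasurable]
    refine lintegral_eq_zero_of_ae_eq_zero ?_
    filter_upwards [h] with m hm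
    exact ae_iff.1 hm
  have hbind : ∀ᶠ n : ℕ in atTop, IsProbabilityMeasure ((edgeNumber ε d n).bind (κ n)) := by
    filter_upwards [hprob, eventually_edgeNumber hε hε1 hd] with n h1 h2
    have := h2.1
    constructor
    rw [Measure.bind_apply .of_discrete (Measurable.of_discrete).aemeasurable]
    have : ∀ᵐ m ∂edgeNumber ε d n, κ n m Set.univ = 1 := by
      filter_upwards [h2.2.1] with m hm
      have := (h1 m hm).1
      exact measure_univ
    rw [lintegral_congr_ae this]
    simp
  -- With at most `d * n / 2` edges, log Z and the centre are each within `β * (d * n / 2)` of the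
  -- edgeless value; hence the constant `β * d`.
  have main := exists_rate_deviationProb (fun n => (edgeNumber ε d n).bind (κ n))
    (fun n G => G.logZ q β) (fun n => measurable_logZ q β)
    (fun n => ∫ G, G.logZ q β ∂κ n (m₀ n)) (β * d) (fun _ => True) ?_ ?_ hδ
  · simpa using main
  · filter_upwards [hprob, hbind, eventually_edgeNumber hε hε1 hd] with n h1 h2 h3 _
    refine ⟨h2, hae n _ ?_⟩
    filter_upwards [h3.2.1] with m hm
    filter_upwards [(h1 m hm).2] with G hG
    have := (h1 _ (hm₀le' n)).1
    have e1 := abs_integral_logZ_sub_le hq hβ.le (h1 _ (hm₀le' n)).2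
    have e2 := abs_logZ_sub_logZ_empty_le hq hβ.le G
    rw [hG] at e2
    have e3 : β * m ≤ β * (d * n / 2) := by gcongr
    have e4 : β * m₀ n ≤ β * (d * n / 2) := by gcongr; exact hm₀le' n
    rw [abs_le] at *
    constructor <;> linarith
  · intro s hs
    obtain ⟨c₁, hc₁, h₁⟩ := hconc (s / 2) (by positivity)
    -- An edge number this close to the Poisson mean is, after rounding, within `2 * (s / (4 * β) *
    -- n)` of `m₀ n`, which moves the conditional mean by at most `s / 2 * n`.
    obtain ⟨c₂, hc₂, h₂⟩ := exists_rate_edgeNumber hε hε1 hd (s := s / (4 * β)) (by positivity)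
    have hc : 0 < min c₁ c₂ := lt_min hc₁ hc₂
    refine ⟨min c₁ c₂ / 2, by positivity, ?_⟩
    -- Absorbs the rounding error of the floor.
    have hlarge : ∀ᶠ n : ℕ in atTop, 1 ≤ s / (4 * β) * (n : ℝ) :=
      (tendsto_natCast_atTop_atTop.const_mul_atTop (by positivity)).eventually_ge_atTop 1
    filter_upwards [h₁, h₂, hprob, hbind, hlip, hlarge, eventually_const_mul_exp_le 2 hc,
      eventually_edgeNumber hε hε1 hd] with n h₁ h₂ hprob hbind hlip hlarge hexp hen _
    have := hen.1
    set A := {G : Multigraph (Fin n) | s * n < |G.logZ q β - ∫ G, G.logZ q β ∂κ n (m₀ n)|}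
    set B := {m : ℕ | s / (4 * β) * n < |(m : ℝ) - meanEdges ε d n|}
    have hκ : ∀ᵐ m ∂edgeNumber ε d n, κ n m A ≤
        B.indicator 1 m + ENNReal.ofReal (Real.exp (-c₁ * n)) := by
      filter_upwards [hen.2.1] with m hm
      have := (hprob m hm).1
      by_cases hB : m ∈ B
      · rw [Set.indicator_of_mem hB]
        exact prob_le_one.trans (by simp)
      · rw [Set.indicator_of_notMem hB, zero_add]
        refine ENNReal.le_ofReal_iff_toReal_le (measure_ne_top _ _) (Real.exp_nonneg _) |>.2 ?_
        refine le_trans (measureReal_mono fun G hG => ?_) (h₁ m hm)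
        have hB' : |(m : ℝ) - meanEdges ε d n| ≤ s / (4 * β) * n := not_lt.1 hB
        have hfl : meanEdges ε d n < m₀ n + 1 := Nat.lt_floor_add_one _
        have hg := abs_sub_le_mul_of_abs_succ_sub_le (g := fun m => ∫ G, G.logZ q β ∂κ n m)
          hlip hm (hm₀le' n)
        have hdist : |(m : ℝ) - m₀ n| ≤ 2 * (s / (4 * β) * n) := by
          have := hm₀le n
          rw [abs_le] at hB' ⊢
          constructor <;> linarith
        have hg' : β * |(m : ℝ) - m₀ n| ≤ s / 2 * n := by
          calc β * |(m : ℝ) - m₀ n| ≤ β * (2 * (s / (4 * β) * n)) := by gcongr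
            _ = s / 2 * n := by field_simp; ring
        have hG' : s * n < |G.logZ q β - ∫ G, G.logZ q β ∂κ n (m₀ n)| := hG
        change s / 2 * n < |G.logZ q β - ∫ G, G.logZ q β ∂κ n m|
        have htri := abs_sub_le (G.logZ q β) (∫ G, G.logZ q β ∂κ n m)
          (∫ G, G.logZ q β ∂κ n (m₀ n))
        linarith
    have hle : ((edgeNumber ε d n).bind (κ n)) A ≤
        edgeNumber ε d n B + ENNReal.ofReal (Real.exp (-c₁ * n)) := by
      rw [Measure.bind_apply .of_discrete (Measurable.of_discrete).aemeasurable]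
      refine (lintegral_mono_ae hκ).trans (le_of_eq ?_)
      rw [lintegral_add_right _ measurable_const, lintegral_indicator_one .of_discrete]
      simp
    have hreal : ((edgeNumber ε d n).bind (κ n)).real A ≤
        (edgeNumber ε d n).real B + Real.exp (-c₁ * n) := by
      have := ENNReal.toReal_mono (by finiteness) hle
      rwa [ENNReal.toReal_add (by finiteness) (by finiteness),
        ENNReal.toReal_ofReal (Real.exp_nonneg _)] at this
    refine (hreal.trans (add_le_add h₂ le_rfl)).trans (le_trans ?_ hexp)
    have hn : (0 : ℝ) ≤ n := n.cast_nonneg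
    have e1 : Real.exp (-c₂ * n) ≤ Real.exp (-min c₁ c₂ * n) := by
      gcongr; exact min_le_right _ _
    have e2 : Real.exp (-c₁ * n) ≤ Real.exp (-min c₁ c₂ * n) := by
      gcongr; exact min_le_left _ _
    linarith

end Mixture

/-! ### The sparsified binomial multigraph -/

section IndependentEdges

/-- The pairs of distinct vertices. -/
abbrev VertexPair (n : ℕ) : Type := {e : Sym2 (Fin n) // ¬ e.IsDiag}

noncomputable instance (n : ℕ) : Fintype (VertexPair n) := Fintype.ofFinite _

lemma nonempty_vertexPair {n : ℕ} (hn : 2 ≤ n) : Nonempty (VertexPair n) :=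
  ⟨⟨s(⟨0, by omega⟩, ⟨1, by omega⟩), by simp⟩⟩

/-- The multigraph with a given sequence of edges. -/
def multigraphOfSeq {n m : ℕ} (x : Fin m → VertexPair n) : Multigraph (Fin n) :=
  ⟨Finset.univ.val.map fun i => (x i : Sym2 (Fin n))⟩

lemma piFinset_vertexPair_nonempty {n : ℕ} (hn : 2 ≤ n) (m : ℕ)
    [DecidablePred fun e : Sym2 (Fin n) => ¬ e.IsDiag] :
    (Fintype.piFinset fun _ : Fin m => ({e : Sym2 (Fin n) | ¬ e.IsDiag} : Finset _)).Nonempty := by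
  obtain ⟨e⟩ := nonempty_vertexPair hn
  exact ⟨fun _ => e.1, by simp [e.2]⟩

/-- Sequences in the subtype `VertexPair n` carry product weights, the form that `localMGFBound_fin`
requires. -/
lemma integral_independentEdges {n m : ℕ} (F : Multigraph (Fin n) → ℝ) :
    ∫ G, F G ∂independentEdges n m =
      wmean (fun x : Fin m → VertexPair n => ∏ i, unifWeight (VertexPair n) (x i))
        (fun x => F (multigraphOfSeq x)) := by
  classical
  rw [independentEdges, integral_uniformLaw _ _ .of_discrete, wmean, Finset.mul_sum]
  have hcard : Fintype.card (VertexPair n) =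
      (Finset.univ.filter fun e : Sym2 (Fin n) => ¬ e.IsDiag).card := Fintype.card_subtype _
  symm
  refine Finset.sum_bij (fun x _ i => (x i : Sym2 (Fin n))) ?_ ?_ ?_ ?_
  · intro x _
    simp only [Fintype.mem_piFinset, Finset.mem_filter, Finset.mem_univ, true_and]
    exact fun i => (x i).2
  · intro x _ y _ h
    ext i : 2
    exact congrFun h i
  · intro y hy
    simp only [Fintype.mem_piFinset, Finset.mem_filter, Finset.mem_univ, true_and] at hy
    exact ⟨fun i => ⟨y i, hy i⟩, Finset.mem_univ _, rfl⟩
  · intro x _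
    simp only [unifWeight, Finset.prod_const, Finset.card_univ, Fintype.card_fin, hcard,
      Fintype.card_piFinset]
    push_cast
    rw [inv_pow]
    congr!

lemma abs_logZ_multigraphOfSeq_update_sub_le {q : ℕ} (hq : 1 ≤ q) {β : ℝ} (hβ : 0 ≤ β) {n m : ℕ}
    (x : Fin m → VertexPair n) (i : Fin m) (a b : VertexPair n) :
    |(multigraphOfSeq (Function.update x i a)).logZ q β -
      (multigraphOfSeq (Function.update x i b)).logZ q β| ≤ β := by
  classical
  have h := abs_logZ_map_sub_le hq hβ (Finset.univ.val : Multiset (Fin m))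
    (fun j => (Function.update x i a j : Sym2 (Fin n)))
    (fun j => (Function.update x i b j : Sym2 (Fin n))) (k := 1) (by
      rw [← Finset.filter_val, Finset.card_val]
      refine (Finset.card_le_card (t := {i}) fun j hj => ?_).trans (by simp)
      by_contra hji
      have hji : j ≠ i := by simpa using hji
      simp [Function.update_of_ne hji] at hj)
  rwa [Nat.cast_one, mul_one] at h

lemma localMGFBound_independentEdges {q : ℕ} (hq : 1 ≤ q) {β : ℝ} (hβ : 0 ≤ β) {n : ℕ}
    (hn : 2 ≤ n) (m : ℕ) :
    LocalMGFBound (fun x : Fin m → VertexPair n => ∏ i, unifWeight (VertexPair n) (x i))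
      (fun x => (multigraphOfSeq x).logZ q β) β (m * β ^ 2) := by
  have := nonempty_vertexPair hn
  have h := localMGFBound_fin (r := β) (fun _ : Fin m => unifWeight (VertexPair n))
    (fun _ => isWeight_unifWeight _) (fun _ => β ^ 2)
    (fun _ g hg => localMGFBound_of_osc_le (isWeight_unifWeight _) hg)
    (fun x => (multigraphOfSeq x).logZ q β)
    (fun x i a b => abs_logZ_multigraphOfSeq_update_sub_le hq hβ x i a b)
  simpa using h

/-- Splitting off the first of `m + 1` edges couples the two models so that they differ by one edge.
-/
lemma abs_integral_independentEdges_succ_sub_le {q : ℕ} (hq : 1 ≤ q) {β : ℝ} (hβ : 0 ≤ β) {n : ℕ}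
    (hn : 2 ≤ n) (m : ℕ) :
    |∫ G, G.logZ q β ∂independentEdges n (m + 1) - ∫ G, G.logZ q β ∂independentEdges n m| ≤ β := by
  have := nonempty_vertexPair hn
  have hw := isWeight_unifWeight (VertexPair n)
  rw [integral_independentEdges, integral_independentEdges,
    wmean_fin_succ (fun _ => unifWeight (VertexPair n)),
    ← wmean_const hw (wmean (fun x : Fin m → VertexPair n => ∏ i, unifWeight (VertexPair n) (x i))
        (fun x => (multigraphOfSeq x).logZ q β)), ← wmean_sub]
  refine abs_wmean_le hw fun a => ?_
  rw [← wmean_sub]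
  refine abs_wmean_le (isWeight_prod fun _ => hw) fun y => ?_
  have h : (multigraphOfSeq (Fin.cons a y : Fin (m + 1) → VertexPair n)) =
      ⟨(multigraphOfSeq y).edges + {(a : Sym2 (Fin n))}⟩ := by
    simp [multigraphOfSeq, Fin.univ_succ, add_comm, Function.comp_def]
  rw [h]
  simpa using abs_logZ_add_sub_le hq hβ (multigraphOfSeq y).edges {(a : Sym2 (Fin n))}

theorem exists_rate_sparsifiedBinomial {q : ℕ} (hq : 1 ≤ q) {ε δ β d : ℝ} (hε : 0 < ε)
    (hε1 : ε ≤ 1) (hδ : 0 < δ) (hβ : 0 < β) (hd : 0 < d) :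
    ∃ ξ : ℝ, 0 < ξ ∧ ∀ᶠ n : ℕ in atTop,
      deviationProb (sparsifiedBinomial ε d n) (fun G => G.logZ q β) (δ * n)
        ≤ Real.exp (-ξ * n) := by
  refine exists_rate_mixture hq hε hε1 hδ hβ hd independentEdges ?_ ?_ fun s hs => ?_
  · filter_upwards [eventually_ge_atTop 2] with n hn m _
    refine ⟨isProbabilityMeasure_uniformLaw _ _ (by convert piFinset_vertexPair_nonempty hn m), ?_⟩
    exact ae_uniformLaw _ _ .of_discrete (by simp)
  · filter_upwards [eventually_ge_atTop 2] with n hn m _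
    exact abs_integral_independentEdges_succ_sub_le hq hβ.le hn m
  · obtain ⟨t, ht0, ht1, hts⟩ := exists_chernoff_parameter (r := β) (v := d / 2 * β ^ 2) (s := s)
      hβ.le (by positivity) hs
    refine ⟨t * s / 2 / 2, by positivity, ?_⟩
    filter_upwards [eventually_const_mul_exp_le 2 (c := t * s / 2) (by positivity),
      eventually_ge_atTop 2] with n hn hn2 m hm
    have h := LocalMGFBound.measureReal_le (isWeight_prod fun _ : Fin m =>
        have := nonempty_vertexPair hn2; isWeight_unifWeight (VertexPair n)).nonneg multigraphOfSeq
      (fun F _ => integral_independentEdges F) (measurable_logZ q β)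
      (localMGFBound_independentEdges hq hβ.le hn2 m) ht0.le ht1 (s * n)
    refine h.trans (le_trans ?_ hn)
    gcongr
    have h1 := mul_le_mul_of_nonneg_left hm (show 0 ≤ t ^ 2 * β ^ 2 by positivity)
    have h2 : (0 : ℝ) ≤ n := n.cast_nonneg
    nlinarith

end IndependentEdges

/-! ### The binomial random graph -/

section BinomialGraph

open Classical in
/-- The weights of a `Prop`-valued Bernoulli variable that is false on the diagonal. -/
noncomputable def edgeIndicatorWeight {n : ℕ} (p : ℝ) (e : Sym2 (Fin n)) (b : Prop) : ℝ :=
  p * (if b = (¬ e.IsDiag) then 1 else 0) + (1 - p) * (if b = False then 1 else 0)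

lemma isWeight_edgeIndicatorWeight {n : ℕ} {p : ℝ} (hp0 : 0 ≤ p) (hp1 : p ≤ 1)
    (e : Sym2 (Fin n)) : IsWeight (edgeIndicatorWeight p e) where
  nonneg b := by
    have : 0 ≤ 1 - p := by linarith
    unfold edgeIndicatorWeight
    positivity
  sum_eq_one := by
    classical
    by_cases he : e.IsDiag <;> simp [edgeIndicatorWeight, he]

/-- The second moment about `g False` carries the factor `p`. A bare `r ^ 2` per pair would add up
to order n², whereas `p ≤ d / n` leaves order n. -/
lemma localMGFBound_edgeIndicatorWeight {n : ℕ} {p : ℝ} (hp0 : 0 ≤ p) (hp1 : p ≤ 1)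
    (e : Sym2 (Fin n)) {r : ℝ} {g : Prop → ℝ} (hg : ∀ a b, |g a - g b| ≤ r) :
    LocalMGFBound (edgeIndicatorWeight p e) g r (p * r ^ 2) := by
  classical
  refine localMGFBound_of_sq_le (isWeight_edgeIndicatorWeight hp0 hp1 e) hg False ?_
  have h : wmean (edgeIndicatorWeight p e) (fun b => (g b - g False) ^ 2) =
      p * (g (¬ e.IsDiag) - g False) ^ 2 := by
    by_cases he : e.IsDiag <;> simp [wmean, edgeIndicatorWeight, he]
  rw [h]
  have := hg (¬ e.IsDiag) False
  exact mul_le_mul_of_nonneg_left (sq_le_sq' (abs_le.1 this).1 (abs_le.1 this).2) hp0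

/-- The multigraph of the simple graph with a given edge indicator. -/
noncomputable def graphOfIndicator {n : ℕ} (ω : Sym2 (Fin n) → Prop) : SimpleGraph (Fin n) :=
  SimpleGraph.fromEdgeSet {e | ω e}

/-- Since `edgeSet` is injective and measurable, any set of graphs is the preimage of a measurable
set. -/
instance (n : ℕ) : DiscreteMeasurableSpace (SimpleGraph (Fin n)) where
  forall_measurableSet S := by
    have h : S = SimpleGraph.edgeSet ⁻¹' (SimpleGraph.edgeSet '' S) :=
      (Set.preimage_image_eq S SimpleGraph.edgeSet_injective).symm
    rw [h]
    exact SimpleGraph.measurable_edgeSet .of_discrete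

/-- Undoing two pushforwards, from graphs to edge sets and from edge sets to indicators, leaves a
product of two-point laws. At a diagonal pair both atoms are `False`. -/
lemma integral_binomialGraph {d : ℝ} {n : ℕ} (F : SimpleGraph (Fin n) → ℝ) :
    ∫ G, F G ∂binomialGraph d n = wmean (fun ω : Sym2 (Fin n) → Prop => ∏ e,
      edgeIndicatorWeight (Set.projIcc (0 : ℝ) 1 zero_le_one (d / n)) e (ω e))
        (fun ω => F (graphOfIndicator ω)) := by
  classical
  set p := Set.projIcc (0 : ℝ) 1 zero_le_one (d / n)
  rw [binomialGraph, SimpleGraph.binomialRandom_eq_map, setBernoulli_eq_map,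
    Measure.infinitePi_eq_pi, integral_map (by fun_prop) (Measurable.of_discrete).aestronglyMeasurable,
    integral_map (by fun_prop) (Measurable.of_discrete).aestronglyMeasurable,
    integral_fintype .of_finite]
  refine Finset.sum_congr rfl fun ω _ => ?_
  rw [smul_eq_mul, measureReal_def, Measure.pi_singleton, ENNReal.toReal_prod]
  congr 1
  refine Finset.prod_congr rfl fun e _ => ?_
  have hd : ∀ b : Prop, Measure.dirac b {ω e} = if ω e = b then 1 else 0 := by
    intro b
    rw [Measure.dirac_apply' _ .of_discrete, Set.indicator_apply]
    simp [eq_comm]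
  have hp : ((unitInterval.toNNReal p : ℝ≥0∞)).toReal = (p : ℝ) := rfl
  have hσ : ((unitInterval.toNNReal (unitInterval.symm p) : ℝ≥0∞)).toReal = 1 - (p : ℝ) := rfl
  rw [Measure.add_apply, Measure.smul_apply, Measure.smul_apply, hd, hd, ENNReal.smul_def,
    ENNReal.smul_def, smul_eq_mul, smul_eq_mul, ENNReal.toReal_add (by split_ifs <;> simp)
    (by split_ifs <;> simp), ENNReal.toReal_mul, ENNReal.toReal_mul]
  change (unitInterval.toNNReal p : ℝ≥0∞).toReal * _ +
    (unitInterval.toNNReal (unitInterval.symm p) : ℝ≥0∞).toReal * _ = _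
  rw [hp, hσ, edgeIndicatorWeight]
  congr 2 <;> split_ifs <;> simp_all

/-- Measured against the graph without `e`, any two values of the indicator yield a common
multigraph plus at most one edge each. -/
lemma edges_graphOfIndicator_update {n : ℕ} (ω : Sym2 (Fin n) → Prop) (e : Sym2 (Fin n))
    (b : Prop) : ∃ A : Multiset (Sym2 (Fin n)), A.card ≤ 1 ∧
      (graphOfIndicator (Function.update ω e b)).toMultigraph.edges =
        (graphOfIndicator (Function.update ω e False)).toMultigraph.edges + A := by
  classical
  have hmem : ∀ c f, f ∈ (graphOfIndicator (Function.update ω e c)).edgeSet ↔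
      (if f = e then c else ω f) ∧ ¬ f.IsDiag := by
    intro c f
    simp [graphOfIndicator, Function.update_apply]
  by_cases h : b ∧ ¬ e.IsDiag
  · refine ⟨{e}, by simp, ?_⟩
    have hne : e ∉ (graphOfIndicator (Function.update ω e False)).edgeSet.toFinite.toFinset := by
      simp [hmem]
    simp only [SimpleGraph.toMultigraph]
    rw [Multiset.add_comm, Multiset.singleton_add, ← Finset.insert_val_of_notMem hne]
    congr 1
    ext f
    rw [Set.Finite.mem_toFinset, Finset.mem_insert, Set.Finite.mem_toFinset, hmem, hmem]
    by_cases hf : f = e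
    · subst hf; simpa using h
    · simp [hf]
  · refine ⟨0, by simp, ?_⟩
    simp only [SimpleGraph.toMultigraph, add_zero]
    congr 1
    ext f
    rw [Set.Finite.mem_toFinset, Set.Finite.mem_toFinset, hmem, hmem]
    by_cases hf : f = e
    · subst hf; simpa using h
    · simp [hf]

lemma localMGFBound_binomialGraph {q : ℕ} (hq : 1 ≤ q) {β : ℝ} (hβ : 0 ≤ β) {n : ℕ} {p : ℝ}
    (hp0 : 0 ≤ p) (hp1 : p ≤ 1) :
    LocalMGFBound (fun ω : Sym2 (Fin n) → Prop => ∏ e, edgeIndicatorWeight p e (ω e))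
      (fun ω => (graphOfIndicator ω).toMultigraph.logZ q β) β
      (((n + 1).choose 2 : ℕ) * (p * β ^ 2)) := by
  classical
  have h := localMGFBound_pi (r := β) (edgeIndicatorWeight (n := n) p)
    (isWeight_edgeIndicatorWeight hp0 hp1) (fun _ => p * β ^ 2)
    (fun e g hg => localMGFBound_edgeIndicatorWeight hp0 hp1 e hg)
    (fun ω => (graphOfIndicator ω).toMultigraph.logZ q β) (fun ω e a b => by
      obtain ⟨A, hA, hA'⟩ := edges_graphOfIndicator_update ω e a
      obtain ⟨B, hB, hB'⟩ := edges_graphOfIndicator_update ω e b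
      have := abs_logZ_add_sub_logZ_add_le hq hβ
        (graphOfIndicator (Function.update ω e False)).toMultigraph.edges A B hA hB
      rwa [← hA', ← hB', Nat.cast_one, mul_one] at this)
  convert h using 1
  simp [Sym2.card]

theorem exists_rate_binomialGraph {q : ℕ} (hq : 1 ≤ q) {δ β d : ℝ} (hδ : 0 < δ) (hβ : 0 < β)
    (hd : 0 < d) :
    ∃ ξ : ℝ, 0 < ξ ∧ ∀ᶠ n : ℕ in atTop,
      deviationProb (binomialGraph d n) (fun G => G.toMultigraph.logZ q β) (δ * n)
        ≤ Real.exp (-ξ * n) := by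
  obtain ⟨t, ht0, ht1, hts⟩ := exists_chernoff_parameter (r := β) (v := d * β ^ 2) (s := δ)
    hβ.le (by positivity) hδ
  refine ⟨t * δ / 2 / 2, by positivity, ?_⟩
  filter_upwards [eventually_const_mul_exp_le 2 (c := t * δ / 2) (by positivity),
    eventually_ge_atTop 1] with n hn hn1
  set p := Set.projIcc (0 : ℝ) 1 zero_le_one (d / n) with hp
  have h := LocalMGFBound.measureReal_le (μ := binomialGraph d n)
    (isWeight_prod fun e : Sym2 (Fin n) => isWeight_edgeIndicatorWeight p.2.1 p.2.2 e).nonneg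
    graphOfIndicator (fun F _ => integral_binomialGraph F)
    (X := fun G => G.toMultigraph.logZ q β) .of_discrete
    (localMGFBound_binomialGraph hq hβ.le p.2.1 p.2.2) ht0.le ht1 (δ * n)
  refine h.trans (le_trans ?_ hn)
  have hn0 : (0 : ℝ) < n := by exact_mod_cast hn1
  have hpd : (p : ℝ) ≤ d / n := by
    rw [hp, Set.coe_projIcc]
    exact max_le (by positivity) (min_le_right _ _)
  -- The coordinates include the diagonal pairs, hence `n + 1`. Multiplied by `p ≤ d / n`, their
  -- number becomes linear in `n`.
  have hch : (((n + 1).choose 2 : ℕ) : ℝ) ≤ n * n := by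
    rw [Nat.cast_choose_two]
    have : (1 : ℝ) ≤ n := by exact_mod_cast hn1
    push_cast
    nlinarith
  have hv : (((n + 1).choose 2 : ℕ) : ℝ) * (p * β ^ 2) ≤ d * β ^ 2 * n := by
    calc (((n + 1).choose 2 : ℕ) : ℝ) * (p * β ^ 2) ≤ (n * n) * (d / n * β ^ 2) := by
          gcongr
          exact mul_nonneg p.2.1 (sq_nonneg _)
      _ = d * β ^ 2 * n := by field_simp
  gcongr
  have h1 := mul_le_mul_of_nonneg_left hv (sq_nonneg t)
  nlinarith

end BinomialGraph

/-! ### Uniform matchings as images under uniform permutations -/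

section Matchings

variable {X : Type*}

/-- The action of a permutation on edges. -/
def permEdge (π : Equiv.Perm X) : Sym2 X ↪ Sym2 X :=
  ⟨Sym2.map π, Sym2.map.injective π.injective⟩

lemma map_permEdge_mul (π τ : Equiv.Perm X) (M : Finset (Sym2 X)) :
    M.map (permEdge (π * τ)) = (M.map (permEdge τ)).map (permEdge π) := by
  rw [Finset.map_map]
  congr 1
  ext e
  simp [permEdge, Sym2.map_map, Equiv.Perm.coe_mul]

/-- The endpoints of the edges of a matching. -/
noncomputable def matchingEnd (M : Finset (Sym2 X)) (p : M × Bool) : X :=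
  bif p.2 then (Quot.out p.1.1).2 else (Quot.out p.1.1).1

lemma mk_matchingEnd (M : Finset (Sym2 X)) (e : M) :
    s(matchingEnd M (e, false), matchingEnd M (e, true)) = e.1 := Quot.out_eq e.1

lemma matchingEnd_mem (M : Finset (Sym2 X)) (e : M) (b : Bool) : matchingEnd M (e, b) ∈ e.1 := by
  rw [← mk_matchingEnd M e]
  cases b <;> simp

variable [Fintype X]

lemma mem_matchings {m : ℕ} {M : Finset (Sym2 X)} : M ∈ matchings X m ↔
    M.card = m ∧ (∀ e ∈ M, ¬ e.IsDiag) ∧ ∀ e ∈ M, ∀ f ∈ M, e ≠ f → ∀ x ∈ e, x ∉ f := by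
  simp [matchings]

lemma eq_of_mem_of_mem_matching {m : ℕ} {M : Finset (Sym2 X)} (hM : M ∈ matchings X m)
    {e f : Sym2 X} (he : e ∈ M) (hf : f ∈ M) {x : X} (hxe : x ∈ e) (hxf : x ∈ f) : e = f := by
  by_contra h
  exact (mem_matchings.1 hM).2.2 e he f hf h x hxe hxf

lemma map_permEdge_mem_matchings {m : ℕ} {M : Finset (Sym2 X)} (hM : M ∈ matchings X m)
    (π : Equiv.Perm X) : M.map (permEdge π) ∈ matchings X m := by
  obtain ⟨h1, h2, h3⟩ := mem_matchings.1 hM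
  refine mem_matchings.2 ⟨by rw [Finset.card_map, h1], ?_, ?_⟩
  · intro e he
    obtain ⟨e, he', rfl⟩ := Finset.mem_map.1 he
    have := h2 e he'
    induction e with | _ x y
    simpa [permEdge] using this
  · intro e he f hf hef x hxe hxf
    obtain ⟨e, he', rfl⟩ := Finset.mem_map.1 he
    obtain ⟨f, hf', rfl⟩ := Finset.mem_map.1 hf
    obtain ⟨a, ha, rfl⟩ := Sym2.mem_map.1 hxe
    obtain ⟨b, hb, hab⟩ := Sym2.mem_map.1 hxf
    obtain rfl := π.injective hab
    exact hef (congrArg _ (eq_of_mem_of_mem_matching hM he' hf' ha hb))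

lemma exists_perm_comp_eq {ι : Type*} {u v : ι → X} (hu : Function.Injective u)
    (hv : Function.Injective v) : ∃ π : Equiv.Perm X, ∀ i, π (u i) = v i := by
  classical
  let e : {x // x ∈ Set.range u} ≃ {x // x ∈ Set.range v} :=
    (Equiv.ofInjective u hu).symm.trans (Equiv.ofInjective v hv)
  refine ⟨e.extendSubtype, fun i => ?_⟩
  rw [Equiv.extendSubtype_apply_of_mem _ _ ⟨i, rfl⟩]
  have : (Equiv.ofInjective u hu).symm ⟨u i, ⟨i, rfl⟩⟩ = i := by
    rw [Equiv.symm_apply_eq]; rfl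
  simp [e, this]

lemma matchingEnd_injective {m : ℕ} {M : Finset (Sym2 X)} (hM : M ∈ matchings X m) :
    Function.Injective (matchingEnd M) := by
  rintro ⟨e, b⟩ ⟨f, c⟩ h
  have hef : e.1 = f.1 := eq_of_mem_of_mem_matching hM e.2 f.2 (matchingEnd_mem M e b)
    (h ▸ matchingEnd_mem M f c)
  obtain rfl := Subtype.ext hef
  have hd := (mem_matchings.1 hM).2.1 e.1 e.2
  rw [← mk_matchingEnd M e, Sym2.mk_isDiag_iff] at hd
  cases b <;> cases c <;> simp_all

/-- Transitivity of the symmetric group on matchings of a given size: a bijection between the edges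
induces one between their ends, and this extends to a permutation of `X`. -/
lemma exists_map_permEdge_eq {m : ℕ} {M M' : Finset (Sym2 X)} (hM : M ∈ matchings X m)
    (hM' : M' ∈ matchings X m) : ∃ π : Equiv.Perm X, M.map (permEdge π) = M' := by
  have hc := (mem_matchings.1 hM).1.trans (mem_matchings.1 hM').1.symm
  let θ : M ≃ M' := Finset.equivOfCardEq hc
  obtain ⟨π, hπ⟩ := exists_perm_comp_eq (matchingEnd_injective hM)
    (v := fun p : M × Bool => matchingEnd M' (θ p.1, p.2)) (by
      rintro ⟨e, b⟩ ⟨f, c⟩ h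
      have := matchingEnd_injective hM' h
      simpa using this)
  refine ⟨π, Finset.eq_of_subset_of_card_le (fun f hf => ?_) (by rw [Finset.card_map, hc])⟩
  obtain ⟨e, he, rfl⟩ := Finset.mem_map.1 hf
  have h : permEdge π e = θ ⟨e, he⟩ := by
    rw [← mk_matchingEnd M' (θ ⟨e, he⟩), ← hπ (⟨e, he⟩, false), ← hπ (⟨e, he⟩, true)]
    exact congrArg (permEdge π) (mk_matchingEnd M ⟨e, he⟩).symm
  rw [h]
  exact (θ ⟨e, he⟩).2

/-- A uniformly random permutation maps a fixed matching to a uniformly random matching. -/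
lemma wmean_perm_matching [DecidableEq X] {m : ℕ} {M₀ : Finset (Sym2 X)}
    (hM₀ : M₀ ∈ matchings X m) (F : Finset (Sym2 X) → ℝ) :
    ((matchings X m).card : ℝ)⁻¹ * ∑ M ∈ matchings X m, F M =
      wmean (unifWeight (Equiv.Perm X)) (fun π => F (M₀.map (permEdge π))) := by
  have h1 : ∀ π : Equiv.Perm X,
      ∑ M ∈ matchings X m, F (M.map (permEdge π)) = ∑ M ∈ matchings X m, F M := by
    intro π
    refine Finset.sum_bij' (fun M _ => M.map (permEdge π)) (fun M _ => M.map (permEdge π⁻¹))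
      (fun M hM => map_permEdge_mem_matchings hM _) (fun M hM => map_permEdge_mem_matchings hM _)
      ?_ ?_ (fun _ _ => rfl)
    · intro M _
      rw [← map_permEdge_mul, inv_mul_cancel]
      ext e; simp [permEdge]
    · intro M _
      rw [← map_permEdge_mul, mul_inv_cancel]
      ext e; simp [permEdge]
  -- By transitivity `M` is the image of `M₀` under some `τ`, and right translation by `τ` preserves
  -- the uniform law; so the average does not depend on `M`.
  have h2 : ∀ M ∈ matchings X m, wmean (unifWeight (Equiv.Perm X))
      (fun π => F (M.map (permEdge π))) =
      wmean (unifWeight (Equiv.Perm X)) (fun π => F (M₀.map (permEdge π))) := by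
    intro M hM
    obtain ⟨τ, rfl⟩ := exists_map_permEdge_eq hM₀ hM
    rw [wmean_unifWeight_equiv (Equiv.mulRight τ) (fun π => F (M₀.map (permEdge π)))]
    simp only [Equiv.coe_mulRight, map_permEdge_mul]
  have hcard : ((matchings X m).card : ℝ) ≠ 0 := by
    exact_mod_cast Finset.card_ne_zero_of_mem hM₀
  -- Each permutation permutes the matchings, so averaging over permutations leaves the sum
  -- unchanged.
  have h3 : ∑ M ∈ matchings X m, F M = ∑ M ∈ matchings X m, wmean (unifWeight (Equiv.Perm X))
      (fun π => F (M.map (permEdge π))) := by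
    simp only [wmean]
    rw [Finset.sum_comm]
    simp only [unifWeight, ← Finset.mul_sum, h1]
    rw [Finset.sum_const, Finset.card_univ, nsmul_eq_mul, inv_mul_cancel_left₀]
    exact_mod_cast Fintype.card_ne_zero
  rw [h3, Finset.sum_congr rfl h2, Finset.sum_const, nsmul_eq_mul, inv_mul_cancel_left₀ hcard]

lemma exists_matching_of_embedding {m : ℕ} (u : Fin m × Bool ↪ X) :
    ∃ M ∈ matchings X m, ∀ e, e ∈ M ↔ ∃ i, s(u (i, false), u (i, true)) = e := by
  have hu : ∀ {i j b c}, u (i, b) = u (j, c) ↔ i = j ∧ b = c := by simp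
  have hinj : Function.Injective fun i => s(u (i, false), u (i, true)) := by
    intro i j h
    simp only at h
    have : u (i, false) ∈ s(u (j, false), u (j, true)) := by
      rw [← h]; simp
    rcases Sym2.mem_iff.1 this with h | h
    · exact (hu.1 h).1
    · exact (hu.1 h).1
  refine ⟨Finset.univ.map ⟨_, hinj⟩, mem_matchings.2 ⟨by simp, ?_, ?_⟩, fun e => by simp⟩
  · intro e he
    obtain ⟨i, _, rfl⟩ := Finset.mem_map.1 he
    simp
  · intro e he f hf hef x hxe hxf
    obtain ⟨i, _, rfl⟩ := Finset.mem_map.1 he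
    obtain ⟨j, _, rfl⟩ := Finset.mem_map.1 hf
    have hij : i = j := by
      simp only [Function.Embedding.coeFn_mk, Sym2.mem_iff] at hxe hxf
      rcases hxe with rfl | rfl <;> rcases hxf with h | h <;> exact (hu.1 h).1
    exact hef (by rw [hij])

lemma matchings_nonempty {m : ℕ} (hm : 2 * m ≤ Fintype.card X) : (matchings X m).Nonempty := by
  obtain ⟨u⟩ : Nonempty (Fin m × Bool ↪ X) :=
    Function.Embedding.nonempty_of_card_le (by simpa [mul_comm] using hm)
  obtain ⟨M, hM, -⟩ := exists_matching_of_embedding u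
  exact ⟨M, hM⟩

lemma erase_mem_matchings [DecidableEq X] {m : ℕ} {M : Finset (Sym2 X)}
    (hM : M ∈ matchings X (m + 1)) {e : Sym2 X} (he : e ∈ M) : M.erase e ∈ matchings X m := by
  obtain ⟨h1, h2, h3⟩ := mem_matchings.1 hM
  refine mem_matchings.2 ⟨by rw [Finset.card_erase_of_mem he, h1]; rfl, ?_, ?_⟩
  · exact fun f hf => h2 f (Finset.mem_of_mem_erase hf)
  · exact fun f hf g hg => h3 f (Finset.mem_of_mem_erase hf) g (Finset.mem_of_mem_erase hg)

end Matchings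

/-! ### The configuration model and the sparsified regular multigraph -/

section ConfigurationModel

/-- The multigraph obtained from a set of edges on the clones. -/
def projectEdges {d n : ℕ} (M : Finset (Sym2 (Fin n × Fin d))) : Multigraph (Fin n) :=
  ⟨M.val.map (Sym2.map Prod.fst)⟩

lemma projectEdges_map_permEdge {d n : ℕ} (M : Finset (Sym2 (Fin n × Fin d)))
    (π : Equiv.Perm (Fin n × Fin d)) :
    projectEdges (M.map (permEdge π)) =
      ⟨M.val.map fun e => Sym2.map Prod.fst (Sym2.map π e)⟩ := by
  simp [projectEdges, permEdge]

lemma integral_configurationModel {d n m : ℕ} {M₀ : Finset (Sym2 (Fin n × Fin d))}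
    (hM₀ : M₀ ∈ matchings (Fin n × Fin d) m) (F : Multigraph (Fin n) → ℝ) :
    ∫ G, F G ∂configurationModel d n m = wmean (unifWeight (Equiv.Perm (Fin n × Fin d)))
      (fun π => F (projectEdges (M₀.map (permEdge π)))) := by
  rw [configurationModel, integral_uniformLaw _ _ .of_discrete]
  exact wmean_perm_matching hM₀ fun M => F (projectEdges M)

lemma localMGFBound_configurationModel {q : ℕ} (hq : 1 ≤ q) {β : ℝ} (hβ : 0 ≤ β) {d n m : ℕ}
    {M₀ : Finset (Sym2 (Fin n × Fin d))} (hM₀ : M₀ ∈ matchings (Fin n × Fin d) m) :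
    LocalMGFBound (unifWeight (Equiv.Perm (Fin n × Fin d)))
      (fun π => (projectEdges (M₀.map (permEdge π))).logZ q β) (4 * β)
      (d * n * (4 * β) ^ 2) := by
  classical
  -- The transposition affects only the preimages of `a` and `b`, each on at most one edge of `M₀`.
  -- So at most two edges change, `c = 2 * β`, and the radius is `4 * β`.
  have h := localMGFBound_perm (c := β * (2 : ℕ))
    (fun π => (projectEdges (M₀.map (permEdge π))).logZ q β) (by
    intro π a b
    rw [projectEdges_map_permEdge, projectEdges_map_permEdge]
    refine abs_logZ_map_sub_le hq hβ M₀.val _ _ ?_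
    rw [← Finset.filter_val, Finset.card_val]
    have hone : ∀ x : Fin n × Fin d, (M₀.filter fun e => x ∈ e).card ≤ 1 := by
      intro x
      refine Finset.card_le_one.2 fun e he f hf => ?_
      rw [Finset.mem_filter] at he hf
      exact eq_of_mem_of_mem_matching hM₀ he.1 hf.1 he.2 hf.2
    calc _ ≤ ((M₀.filter fun e => π⁻¹ a ∈ e) ∪ (M₀.filter fun e => π⁻¹ b ∈ e)).card := by
          refine Finset.card_le_card fun e he => ?_
          rw [Finset.mem_filter] at he
          rw [Finset.mem_union, Finset.mem_filter, Finset.mem_filter]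
          by_contra hcon
          push Not at hcon
          refine he.2 (congrArg _ (Sym2.map_congr fun x hx => ?_))
          rw [Equiv.Perm.mul_apply, Equiv.swap_apply_of_ne_of_ne]
          · rintro rfl
            exact hcon.1 he.1 (by simpa using hx)
          · rintro rfl
            exact hcon.2 he.1 (by simpa using hx)
      _ ≤ 1 + 1 := (Finset.card_union_le _ _).trans (add_le_add (hone _) (hone _)))
  convert h using 1
  · push_cast; ring
  · simp only [Fintype.card_prod, Fintype.card_fin]
    push_cast; ring

/-- Applying one permutation to a matching with and without a chosen edge couples the two models. -/
lemma abs_integral_configurationModel_succ_sub_le {q : ℕ} (hq : 1 ≤ q) {β : ℝ} (hβ : 0 ≤ β)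
    {d n m : ℕ} (hm : 2 * (m + 1) ≤ n * d) :
    |∫ G, G.logZ q β ∂configurationModel d n (m + 1) - ∫ G, G.logZ q β ∂configurationModel d n m|
      ≤ β := by
  classical
  obtain ⟨M, hM⟩ := matchings_nonempty (X := Fin n × Fin d) (m := m + 1) (by simpa using hm)
  obtain ⟨e, he⟩ : M.Nonempty := by
    rw [← Finset.card_pos, (mem_matchings.1 hM).1]; omega
  rw [integral_configurationModel hM, integral_configurationModel (erase_mem_matchings hM he),
    ← wmean_sub]
  refine abs_wmean_le (isWeight_unifWeight _) fun π => ?_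
  have h : projectEdges (M.map (permEdge π)) =
      ⟨(projectEdges ((M.erase e).map (permEdge π))).edges +
        {Sym2.map Prod.fst (Sym2.map π e)}⟩ := by
    rw [projectEdges_map_permEdge, projectEdges_map_permEdge]
    congr 1
    conv_lhs => rw [← Finset.insert_erase he,
      Finset.insert_val_of_notMem (Finset.notMem_erase e M), Multiset.map_cons]
    rw [add_comm, Multiset.singleton_add]
  rw [h]
  simpa using abs_logZ_add_sub_le hq hβ (projectEdges ((M.erase e).map (permEdge π))).edges
    {Sym2.map Prod.fst (Sym2.map π e)}

lemma two_mul_le_of_cast_le {d n m : ℕ} (h : (m : ℝ) ≤ d * n / 2) : 2 * m ≤ n * d := by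
  have : (2 * m : ℝ) ≤ n * d := by linarith
  exact_mod_cast this

lemma configurationModel_tail_le {q : ℕ} (hq : 1 ≤ q) {β : ℝ} (hβ : 0 ≤ β) {d : ℕ} {s : ℝ}
    (hs : 0 < s) : ∃ c : ℝ, 0 < c ∧ ∀ᶠ n : ℕ in atTop, ∀ m : ℕ, (m : ℝ) ≤ d * n / 2 →
      (configurationModel d n m).real
        {G | s * n < |G.logZ q β - ∫ G, G.logZ q β ∂configurationModel d n m|}
        ≤ Real.exp (-c * n) := by
  obtain ⟨t, ht0, ht1, hts⟩ := exists_chernoff_parameter (r := 4 * β) (v := d * (4 * β) ^ 2)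
    (s := s) (by positivity) (by positivity) hs
  refine ⟨t * s / 2 / 2, by positivity, ?_⟩
  filter_upwards [eventually_const_mul_exp_le 2 (c := t * s / 2) (by positivity)] with n hn m hm
  obtain ⟨M, hM⟩ := matchings_nonempty (X := Fin n × Fin d) (m := m)
    (by simpa using two_mul_le_of_cast_le hm)
  have h := LocalMGFBound.measureReal_le (isWeight_unifWeight (Equiv.Perm (Fin n × Fin d))).nonneg
    (fun π => projectEdges (M.map (permEdge π))) (fun F _ => integral_configurationModel hM F)
    (measurable_logZ q β) (localMGFBound_configurationModel hq hβ hM) ht0.le ht1 (s * n)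
  refine h.trans (le_trans ?_ hn)
  gcongr
  have h2 : (0 : ℝ) ≤ n := n.cast_nonneg
  nlinarith

theorem exists_rate_sparsifiedRegular {q : ℕ} (hq : 1 ≤ q) {ε δ β : ℝ} (hε : 0 < ε)
    (hε1 : ε ≤ 1) (hδ : 0 < δ) (hβ : 0 < β) {d : ℕ} (hd : 1 ≤ d) :
    ∃ ξ : ℝ, 0 < ξ ∧ ∀ᶠ n : ℕ in atTop,
      deviationProb (sparsifiedRegular ε d n) (fun G => G.logZ q β) (δ * n)
        ≤ Real.exp (-ξ * n) := by
  have hd' : (0 : ℝ) < d := by exact_mod_cast hd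
  refine exists_rate_mixture hq hε hε1 hδ hβ hd' (configurationModel d) ?_ ?_
    fun s hs => configurationModel_tail_le hq hβ.le hs
  · refine Eventually.of_forall fun n m hm => ⟨isProbabilityMeasure_uniformLaw _ _
      (matchings_nonempty (by simpa using two_mul_le_of_cast_le hm)), ?_⟩
    refine ae_uniformLaw _ _ .of_discrete fun M hM => ?_
    simpa using (mem_matchings.1 hM).1
  · exact Eventually.of_forall fun n m hm =>
      abs_integral_configurationModel_succ_sub_le hq hβ.le (two_mul_le_of_cast_le hm)

end ConfigurationModel

/-! ### Switchings: simplicity is at worst polynomially unlikely -/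

section Switching

open Equiv

variable {n d : ℕ}

/-- The dart between the vertices at which the clones `π x` and `π (ι x)` are located. -/
def dartAt (ι : Fin n × Fin d → Fin n × Fin d) (π : Perm (Fin n × Fin d)) (x : Fin n × Fin d) :
    Fin n × Fin n := ((π x).1, (π (ι x)).1)

/-- The points whose dart occurs more than once. -/
def badPoints (ι : Fin n × Fin d → Fin n × Fin d) (π : Perm (Fin n × Fin d)) :
    Finset (Fin n × Fin d) :=
  {x | ∃ y, y ≠ x ∧ dartAt ι π y = dartAt ι π x}

lemma mem_badPoints {ι : Fin n × Fin d → Fin n × Fin d} {π : Perm (Fin n × Fin d)}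
    {x : Fin n × Fin d} :
    x ∈ badPoints ι π ↔ ∃ y, y ≠ x ∧ dartAt ι π y = dartAt ι π x := by
  simp [badPoints]

/-- For a fixed-point-free involution `ι`, a loop gives `x` and `ι x` the same dart, and parallel
edges repeat a dart as well. Injectivity of `dartAt ι π` thus encodes simplicity. -/
lemma badPoints_eq_empty_iff {ι : Fin n × Fin d → Fin n × Fin d} {π : Perm (Fin n × Fin d)} :
    badPoints ι π = ∅ ↔ Function.Injective (dartAt ι π) := by
  rw [Finset.eq_empty_iff_forall_notMem]
  simp only [mem_badPoints, not_exists, not_and]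
  exact ⟨fun h x y hxy => by_contra fun hne => h y x hne hxy, fun h x y hne hxy => hne (h hxy)⟩

lemma card_filter_fst_perm (π : Perm (Fin n × Fin d)) (v : Fin n) :
    (Finset.univ.filter fun x => (π x).1 = v).card = d := by
  have hinj : Function.Injective fun i : Fin d => π.symm (v, i) := fun i j h => by
    simpa using h
  have h : (Finset.univ.filter fun x => (π x).1 = v) = Finset.univ.image fun i => π.symm (v, i) := by
    ext x
    simp only [Finset.mem_filter, Finset.mem_univ, true_and, Finset.mem_image]
    constructor
    · rintro rfl
      exact ⟨(π x).2, by simp⟩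
    · rintro ⟨i, rfl⟩
      simp
  rw [h, Finset.card_image_of_injective _ hinj]
  simp

/-- A random pair of clones rarely belongs to the same vertex, even conditionally on an event that
is invariant under many transpositions moving one of the two clones. -/
lemma card_mul_card_filter_le (Q : Perm (Fin n × Fin d) → Prop) [DecidablePred Q]
    {x z : Fin n × Fin d} (U : Finset (Fin n × Fin d)) (hx : x ∉ U) (hxz : x ≠ z)
    (hQ : ∀ u ∈ U, ∀ π, Q π → Q (π * swap z u)) :
    U.card * (Finset.univ.filter fun π : Perm (Fin n × Fin d) =>
      Q π ∧ (π x).1 = (π z).1).card ≤ d * (Finset.univ.filter Q).card := by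
  classical
  -- Exchanging the clones at `z` and `u` injects the event for `z` into the event for `u`.
  have h1 : ∀ u ∈ U, (Finset.univ.filter fun π : Perm (Fin n × Fin d) =>
      Q π ∧ (π x).1 = (π z).1).card ≤ (Finset.univ.filter fun π : Perm (Fin n × Fin d) =>
      Q π ∧ (π x).1 = (π u).1).card := by
    intro u hu
    refine Finset.card_le_card_of_injOn (fun π => π * swap z u) ?_
      (mul_left_injective (swap z u)).injOn
    intro π hπ
    simp only [Finset.coe_filter, Finset.mem_univ, true_and, Set.mem_ofPred_eq] at hπ ⊢
    refine ⟨hQ u hu π hπ.1, ?_⟩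
    have hxu : x ≠ u := fun h => hx (h ▸ hu)
    simp [Perm.mul_apply, swap_apply_of_ne_of_ne hxz hxu, hπ.2]
  calc U.card * _ = ∑ u ∈ U, (Finset.univ.filter fun π : Perm (Fin n × Fin d) =>
        Q π ∧ (π x).1 = (π z).1).card := by rw [Finset.sum_const, smul_eq_mul]
    _ ≤ ∑ u ∈ U, (Finset.univ.filter fun π : Perm (Fin n × Fin d) =>
        Q π ∧ (π x).1 = (π u).1).card := Finset.sum_le_sum h1
    -- Double counting: for each `π` at most `d` points share the vertex of `x`.
    _ = ∑ π ∈ Finset.univ.filter Q, (U.filter fun u => (π x).1 = (π u).1).card := by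
        simp only [Finset.card_filter, Finset.sum_filter]
        rw [Finset.sum_comm]
        refine Finset.sum_congr rfl fun π _ => ?_
        split_ifs with h <;> simp [h]
    _ ≤ ∑ π ∈ Finset.univ.filter Q, d := by
        refine Finset.sum_le_sum fun π _ => ?_
        refine (Finset.card_le_card fun u hu => ?_).trans (card_filter_fst_perm π (π x).1).le
        rw [Finset.mem_filter] at hu ⊢
        exact ⟨Finset.mem_univ _, hu.2.symm⟩
    _ = d * (Finset.univ.filter Q).card := by rw [Finset.sum_const, smul_eq_mul, mul_comm]

lemma card_filter_same_vertex_le {x z : Fin n × Fin d} (hxz : x ≠ z) :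
    (n * d - 1) * (Finset.univ.filter fun π : Perm (Fin n × Fin d) =>
      (π x).1 = (π z).1).card ≤ d * (n * d).factorial := by
  have h := card_mul_card_filter_le (fun _ => True) (Finset.univ.erase x) (by simp) hxz (by simp)
  simpa [Finset.card_erase_of_mem, Fintype.card_perm] using h

lemma card_filter_loop_le {ι : Fin n × Fin d → Fin n × Fin d} (hfix : ∀ x, ι x ≠ x)
    (hN : 6 ≤ n * d) (x : Fin n × Fin d) :
    n * d * (Finset.univ.filter fun π : Perm (Fin n × Fin d) =>
      dartAt ι π (ι x) = dartAt ι π x).card ≤ 2 * d * (n * d).factorial := by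
  have h : (Finset.univ.filter fun π : Perm (Fin n × Fin d) =>
      dartAt ι π (ι x) = dartAt ι π x) ⊆
      (Finset.univ.filter fun π : Perm (Fin n × Fin d) => (π x).1 = (π (ι x)).1) := by
    intro π hπ
    simp only [Finset.mem_filter, Finset.mem_univ, true_and, dartAt, Prod.mk.injEq] at hπ ⊢
    exact hπ.1.symm
  have h1 := Finset.card_le_card h
  have h2 := card_filter_same_vertex_le (hfix x).symm
  have h3 : n * d ≤ 2 * (n * d - 1) := by omega
  calc _ ≤ 2 * (n * d - 1) * _ := Nat.mul_le_mul h3 h1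
    _ ≤ 2 * (d * (n * d).factorial) := by rw [mul_assoc]; exact Nat.mul_le_mul le_rfl h2
    _ = _ := by ring

/-- Two coincidences are needed, one for `ι x`, `ι y` and one for `x`, `y`. Moving the clone of `y`
to a point other than `x`, `ι x`, `ι y` preserves the first, so each costs a factor of at most `2 *
d / (n * d)`; `6 ≤ n * d` gives `n * d ≤ 2 * (n * d - 3)`. -/
lemma card_filter_parallel_le {ι : Fin n × Fin d → Fin n × Fin d}
    (hι : Function.Involutive ι) (hfix : ∀ x, ι x ≠ x) (hN : 6 ≤ n * d) {x y : Fin n × Fin d} (hyx : y ≠ x)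
    (hyι : y ≠ ι x) :
    (n * d) ^ 2 * (Finset.univ.filter fun π : Perm (Fin n × Fin d) =>
      dartAt ι π y = dartAt ι π x).card ≤ 4 * d ^ 2 * (n * d).factorial := by
  have hιne : ι x ≠ ι y := fun h => hyx (hι.injective h).symm
  have hxιy : x ≠ ι y := fun h => hyι (by rw [h, hι])
  have h1 := card_filter_same_vertex_le hιne
  have h2 := card_mul_card_filter_le (fun π => (π (ι x)).1 = (π (ι y)).1)
    (Finset.univ \ {x, ι x, ι y}) (x := x) (z := y) (by simp) hyx.symm (by
      intro u hu π hπ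
      simp only [Finset.mem_sdiff, Finset.mem_univ, true_and, Finset.mem_insert,
        Finset.mem_singleton, not_or] at hu
      simpa [Perm.mul_apply, swap_apply_of_ne_of_ne hyι.symm (Ne.symm hu.2.1),
        swap_apply_of_ne_of_ne (hfix y) (Ne.symm hu.2.2)] using hπ)
  have hcard : n * d - 3 ≤ (Finset.univ \ {x, ι x, ι y} : Finset (Fin n × Fin d)).card := by
    have := Finset.le_card_sdiff ({x, ι x, ι y} : Finset (Fin n × Fin d)) Finset.univ
    have h3 : ({x, ι x, ι y} : Finset (Fin n × Fin d)).card ≤ 3 := Finset.card_le_three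
    simp only [Finset.card_univ, Fintype.card_prod, Fintype.card_fin] at this
    omega
  have h4 : (Finset.univ.filter fun π : Perm (Fin n × Fin d) => dartAt ι π y = dartAt ι π x) ⊆
      (Finset.univ.filter fun π : Perm (Fin n × Fin d) =>
        (π (ι x)).1 = (π (ι y)).1 ∧ (π x).1 = (π y).1) := by
    intro π hπ
    simp only [Finset.mem_filter, Finset.mem_univ, true_and, dartAt, Prod.mk.injEq] at hπ ⊢
    exact ⟨hπ.2.symm, hπ.1.symm⟩
  have h5 := Finset.card_le_card h4
  set a := (Finset.univ.filter fun π : Perm (Fin n × Fin d) => dartAt ι π y = dartAt ι π x).card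
  set b := (Finset.univ.filter fun π : Perm (Fin n × Fin d) => (π (ι x)).1 = (π (ι y)).1).card
  have h6 : (n * d - 3) * a ≤ d * b := (Nat.mul_le_mul hcard h5).trans h2
  have h7 : n * d ≤ 2 * (n * d - 1) := by omega
  have h8 : n * d ≤ 2 * (n * d - 3) := by omega
  calc (n * d) ^ 2 * a = n * d * (n * d * a) := by ring
    _ ≤ 2 * (n * d - 1) * (2 * (n * d - 3) * a) :=
        Nat.mul_le_mul h7 (Nat.mul_le_mul h8 le_rfl)
    _ = 4 * (n * d - 1) * ((n * d - 3) * a) := by ring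
    _ ≤ 4 * (n * d - 1) * (d * b) := Nat.mul_le_mul le_rfl h6
    _ = 4 * d * ((n * d - 1) * b) := by ring
    _ ≤ 4 * d * (d * (n * d).factorial) := Nat.mul_le_mul le_rfl h1
    _ = _ := by ring

/-- On average over all permutations there are boundedly many bad points. -/
lemma sum_card_badPoints_le {ι : Fin n × Fin d → Fin n × Fin d}
    (hι : Function.Involutive ι) (hfix : ∀ x, ι x ≠ x) (hN : 6 ≤ n * d) :
    ∑ π : Perm (Fin n × Fin d), (badPoints ι π).card ≤
      (2 * d + 4 * d ^ 2) * (n * d).factorial := by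
  have h1 : ∀ π : Perm (Fin n × Fin d), (badPoints ι π).card ≤
      ∑ x, ∑ y ∈ Finset.univ.erase x, if dartAt ι π y = dartAt ι π x then 1 else 0 := by
    intro π
    rw [badPoints, Finset.card_filter]
    refine Finset.sum_le_sum fun x _ => ?_
    split_ifs with h
    · obtain ⟨y, hyx, hy⟩ := h
      refine le_trans (by rw [if_pos hy]) (Finset.single_le_sum
        (f := fun y => if dartAt ι π y = dartAt ι π x then 1 else 0) (fun _ _ => Nat.zero_le _)
        (Finset.mem_erase.2 ⟨hyx, Finset.mem_univ y⟩))
    · exact Nat.zero_le _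
  have h2 : ∀ x : Fin n × Fin d, ∑ y ∈ Finset.univ.erase x,
      n * d * (Finset.univ.filter fun π : Perm (Fin n × Fin d) =>
        dartAt ι π y = dartAt ι π x).card ≤ (2 * d + 4 * d ^ 2) * (n * d).factorial := by
    intro x
    -- Only the partner `ι x` coincides with `x` with probability of order 1/n. All other points
    -- have order 1/n², and together they again contribute order 1/n.
    rw [← Finset.add_sum_erase _ _ (Finset.mem_erase.2 ⟨hfix x, Finset.mem_univ _⟩), add_mul]
    refine add_le_add (card_filter_loop_le hfix hN x) ?_
    refine Nat.le_of_mul_le_mul_left (c := n * d) ?_ (by omega)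
    rw [Finset.mul_sum]
    calc _ ≤ ∑ y ∈ (Finset.univ.erase x).erase (ι x), 4 * d ^ 2 * (n * d).factorial := by
          refine Finset.sum_le_sum fun y hy => ?_
          rw [Finset.mem_erase, Finset.mem_erase] at hy
          rw [← mul_assoc, ← sq]
          exact card_filter_parallel_le hι hfix hN hy.2.1 hy.1
      _ ≤ n * d * (4 * d ^ 2 * (n * d).factorial) := by
          rw [Finset.sum_const, smul_eq_mul]
          refine Nat.mul_le_mul ((Finset.card_le_univ _).trans ?_) le_rfl
          simp
  refine Nat.le_of_mul_le_mul_left (c := n * d) ?_ (by omega)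
  calc n * d * ∑ π : Perm (Fin n × Fin d), (badPoints ι π).card
      ≤ n * d * ∑ π : Perm (Fin n × Fin d), ∑ x, ∑ y ∈ Finset.univ.erase x,
          if dartAt ι π y = dartAt ι π x then 1 else 0 :=
        Nat.mul_le_mul le_rfl (Finset.sum_le_sum fun π _ => h1 π)
    _ = ∑ x, ∑ y ∈ Finset.univ.erase x,
          n * d * (Finset.univ.filter fun π : Perm (Fin n × Fin d) =>
            dartAt ι π y = dartAt ι π x).card := by
        simp only [Finset.card_filter, Finset.mul_sum]
        rw [Finset.sum_comm]
        refine Finset.sum_congr rfl fun x _ => ?_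
        rw [Finset.sum_comm]
    _ ≤ ∑ x : Fin n × Fin d, (2 * d + 4 * d ^ 2) * (n * d).factorial :=
        Finset.sum_le_sum fun x _ => h2 x
    _ = _ := by simp

/-- Exchanging the clones at a bad point and at a suitable other point reduces the number of bad
points. -/
lemma card_badPoints_mul_swap_lt {ι : Fin n × Fin d → Fin n × Fin d}
    (hι : Function.Involutive ι) (hfix : ∀ x, ι x ≠ x) {π : Perm (Fin n × Fin d)} {x z : Fin n × Fin d}
    (hx : x ∈ badPoints ι π) (hz : z ∉ badPoints ι π) (hCA : (π z).1 ≠ (π x).1)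
    (hCB : (π z).1 ≠ (π (ι x)).1) (hDA : (π (ι z)).1 ≠ (π x).1)
    (hCB' : ∀ w, (π w).1 = (π (ι x)).1 → (π (ι w)).1 ≠ (π z).1)
    (hDA' : ∀ w, (π w).1 = (π x).1 → (π (ι w)).1 ≠ (π (ι z)).1) :
    (badPoints ι (π * swap x z)).card < (badPoints ι π).card := by
  have hzx : z ≠ x := fun h => hCA (by rw [h])
  have hzιx : z ≠ ι x := fun h => hCB (by rw [h])
  have hιzx : ι z ≠ x := fun h => hzιx (by rw [← h, hι])
  have hιzιx : ι z ≠ ι x := fun h => hzx (hι.injective h)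
  -- Let A, B, C, D be the vertices at `x`, `ι x`, `z`, `ι z`. The swap replaces the edges AB, CD by
  -- CB, AD. As `z` is not bad, CD is no loop.
  have hCD : (π z).1 ≠ (π (ι z)).1 := fun h =>
    hz (mem_badPoints.2 ⟨ι z, hfix z, by simp [dartAt, hι z, h]⟩)
  have ex : dartAt ι (π * swap x z) x = ((π z).1, (π (ι x)).1) := by
    simp [dartAt, Perm.mul_apply, swap_apply_of_ne_of_ne (hfix x) hzιx.symm]
  have ez : dartAt ι (π * swap x z) z = ((π x).1, (π (ι z)).1) := by
    simp [dartAt, Perm.mul_apply, swap_apply_of_ne_of_ne hιzx (hfix z)]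
  have eι : ∀ w, dartAt ι (π * swap x z) (ι w) = (dartAt ι (π * swap x z) w).swap := by
    intro w
    simp [dartAt, hι w]
  have eo : ∀ w, w ≠ x → w ≠ z → w ≠ ι x → w ≠ ι z →
      dartAt ι (π * swap x z) w = dartAt ι π w := by
    intro w h1 h2 h3 h4
    have h5 : ι w ≠ x := fun h => h3 (by rw [← h, hι])
    have h6 : ι w ≠ z := fun h => h4 (by rw [← h, hι])
    simp [dartAt, Perm.mul_apply, swap_apply_of_ne_of_ne h1 h2, swap_apply_of_ne_of_ne h5 h6]
  have eιx := eι x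
  have eιz := eι z
  rw [ex] at eιx
  rw [ez] at eιz
  -- The dart (C, B) differs from the other three new darts, and an unchanged dart (C, B) would make
  -- C a neighbour of B.
  have ux : ∀ y, dartAt ι (π * swap x z) y = dartAt ι (π * swap x z) x → y = x := by
    intro y hy
    by_contra h1
    rw [ex] at hy
    by_cases h2 : y = z
    · rw [h2, ez, Prod.mk.injEq] at hy
      exact hCA hy.1.symm
    by_cases h3 : y = ι x
    · rw [h3, eιx, Prod.swap_prod_mk, Prod.mk.injEq] at hy
      exact hCB hy.2
    by_cases h4 : y = ι z
    · rw [h4, eιz, Prod.swap_prod_mk, Prod.mk.injEq] at hy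
      exact hCD hy.1.symm
    · rw [eo y h1 h2 h3 h4, dartAt, Prod.mk.injEq] at hy
      exact hCB' (ι y) hy.2 (by rw [hι]; exact hy.1)
  have uz : ∀ y, dartAt ι (π * swap x z) y = dartAt ι (π * swap x z) z → y = z := by
    intro y hy
    by_contra h2
    rw [ez] at hy
    by_cases h1 : y = x
    · rw [h1, ex, Prod.mk.injEq] at hy
      exact hCA hy.1
    by_cases h3 : y = ι x
    · rw [h3, eιx, Prod.swap_prod_mk, Prod.mk.injEq] at hy
      exact hCD hy.2
    by_cases h4 : y = ι z
    · rw [h4, eιz, Prod.swap_prod_mk, Prod.mk.injEq] at hy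
      exact hDA hy.1
    · rw [eo y h1 h2 h3 h4, dartAt, Prod.mk.injEq] at hy
      exact hDA' y hy.1 hy.2
  have uι : ∀ t, (∀ y, dartAt ι (π * swap x z) y = dartAt ι (π * swap x z) t → y = t) →
      ∀ y, dartAt ι (π * swap x z) y = dartAt ι (π * swap x z) (ι t) → y = ι t := by
    intro t ht y hy
    have := ht (ι y) (by rw [eι, hy, eι, Prod.swap_swap])
    rw [← this, hι]
  have uιx := uι x ux
  have uιz := uι z uz
  -- The four changed points now carry unique darts, so any point still bad was bad before, and `x`
  -- has been repaired.
  refine Finset.card_lt_card (Finset.ssubset_iff_of_subset ?_ |>.2 ⟨x, hx, ?_⟩)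
  · intro w hw
    obtain ⟨y, hyw, hy⟩ := mem_badPoints.1 hw
    refine mem_badPoints.2 ⟨y, hyw, ?_⟩
    rw [← eo y (fun h => hyw ?_) (fun h => hyw ?_) (fun h => hyw ?_) (fun h => hyw ?_),
      ← eo w (fun h => hyw ?_) (fun h => hyw ?_) (fun h => hyw ?_) (fun h => hyw ?_), hy]
    · rw [h]; rw [h] at hy; exact ux y hy
    · rw [h]; rw [h] at hy; exact uz y hy
    · rw [h]; rw [h] at hy; exact uιx y hy
    · rw [h]; rw [h] at hy; exact uιz y hy
    · rw [h]; rw [h] at hy; exact (ux w hy.symm).symm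
    · rw [h]; rw [h] at hy; exact (uz w hy.symm).symm
    · rw [h]; rw [h] at hy; exact (uιx w hy.symm).symm
    · rw [h]; rw [h] at hy; exact (uιz w hy.symm).symm
  · intro hw
    obtain ⟨y, hyw, hy⟩ := mem_badPoints.1 hw
    exact hyw (ux y hy)

/-- Counting the forbidden `z`: at most `K` bad points, at most `(d + 2) * d` points at the vertex
of `x` or in the closed neighbourhood of that of `ι x`, and at most `(d + 1) * d` points whose
partner lies in the closed neighbourhood of that of `x`. -/
lemma exists_card_badPoints_mul_swap_lt {ι : Fin n × Fin d → Fin n × Fin d}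
    (hι : Function.Involutive ι) (hfix : ∀ x, ι x ≠ x) {π : Perm (Fin n × Fin d)} {K : ℕ}
    (hK : (badPoints ι π).card ≤ K) (hN : d * (2 * d + 3) + K < n * d)
    (hne : (badPoints ι π).Nonempty) :
    ∃ x z, (badPoints ι (π * swap x z)).card < (badPoints ι π).card := by
  classical
  obtain ⟨x, hx⟩ := hne
  let nbr : Fin n → Finset (Fin n) := fun v =>
    insert v ((Finset.univ.filter fun w => (π w).1 = v).image fun w => (π (ι w)).1)
  have hnbr : ∀ v, (nbr v).card ≤ d + 1 := fun v => by
    refine (Finset.card_insert_le _ _).trans (Nat.add_le_add_right ?_ 1)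
    exact Finset.card_image_le.trans (card_filter_fst_perm π v).le
  have hcount : ∀ T : Finset (Fin n), (Finset.univ.filter fun w => (π w).1 ∈ T).card ≤ T.card * d := by
    intro T
    have : (Finset.univ.filter fun w => (π w).1 ∈ T) ⊆
        T.biUnion fun v => Finset.univ.filter fun w => (π w).1 = v := by
      intro w hw
      simpa using hw
    refine (Finset.card_le_card this).trans (Finset.card_biUnion_le.trans ?_)
    simp only [card_filter_fst_perm, Finset.sum_const, smul_eq_mul, le_refl]
  have hcount' : ∀ T : Finset (Fin n),
      (Finset.univ.filter fun w => (π (ι w)).1 ∈ T).card ≤ T.card * d := by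
    intro T
    refine le_trans ?_ (hcount T)
    refine Finset.card_le_card_of_injOn ι (fun w hw => ?_) hι.injective.injOn
    simpa using hw
  let E : Finset (Fin n × Fin d) := badPoints ι π ∪
    ((Finset.univ.filter fun w => (π w).1 ∈ insert (π x).1 (nbr (π (ι x)).1)) ∪
      (Finset.univ.filter fun w => (π (ι w)).1 ∈ nbr (π x).1))
  have hE : E.card < (Finset.univ : Finset (Fin n × Fin d)).card := by
    have h1 : E.card ≤ K + ((d + 2) * d + (d + 1) * d) := by
      refine (Finset.card_union_le _ _).trans (add_le_add hK ?_)
      refine (Finset.card_union_le _ _).trans (add_le_add ((hcount _).trans ?_)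
        ((hcount' _).trans ?_))
      · refine Nat.mul_le_mul ((Finset.card_insert_le _ _).trans ?_) le_rfl
        have := hnbr (π (ι x)).1
        omega
      · exact Nat.mul_le_mul (hnbr _) le_rfl
    have h2 : (d + 2) * d + (d + 1) * d = d * (2 * d + 3) := by ring
    simp only [Finset.card_univ, Fintype.card_prod, Fintype.card_fin]
    omega
  obtain ⟨z, -, hz⟩ := Finset.exists_mem_notMem_of_card_lt_card hE
  simp only [E, nbr, Finset.mem_union, Finset.mem_filter, Finset.mem_univ, true_and,
    Finset.mem_insert, Finset.mem_image, not_or, not_exists, not_and] at hz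
  exact ⟨x, z, card_badPoints_mul_swap_lt hι hfix hx hz.1 hz.2.1.1 hz.2.1.2.1 hz.2.2.1
    hz.2.1.2.2 hz.2.2.2⟩

/-- Swaps are invertible, so each permutation with at most `k + 1` bad points arises from one with
at most `k` by one of `(n * d) ^ 2` swaps. -/
lemma card_filter_badPoints_le_mul {ι : Fin n × Fin d → Fin n × Fin d}
    (hι : Function.Involutive ι) (hfix : ∀ x, ι x ≠ x) {K k : ℕ} (hk : k + 1 ≤ K)
    (hN : d * (2 * d + 3) + K < n * d) :
    (Finset.univ.filter fun π : Perm (Fin n × Fin d) => (badPoints ι π).card ≤ k + 1).card ≤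
      (n * d) ^ 2 *
        (Finset.univ.filter fun π : Perm (Fin n × Fin d) => (badPoints ι π).card ≤ k).card := by
  classical
  have h : (Finset.univ.filter fun π : Perm (Fin n × Fin d) => (badPoints ι π).card ≤ k + 1) ⊆
      (Finset.univ : Finset ((Fin n × Fin d) × (Fin n × Fin d))).biUnion fun p =>
        (Finset.univ.filter fun π : Perm (Fin n × Fin d) => (badPoints ι π).card ≤ k).image
          fun π => π * swap p.1 p.2 := by
    intro π hπ
    simp only [Finset.mem_filter, Finset.mem_univ, true_and] at hπ
    have key : ∃ x z, (badPoints ι (π * swap x z)).card ≤ k := by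
      by_cases hne : (badPoints ι π).Nonempty
      · obtain ⟨x, z, h⟩ := exists_card_badPoints_mul_swap_lt hι hfix (hπ.trans hk) hN hne
        exact ⟨x, z, by omega⟩
      · have hpos : 0 < n * d := by omega
        have hd : 0 < d := Nat.pos_of_mul_pos_left hpos
        have hn : 0 < n := Nat.pos_of_mul_pos_right hpos
        -- Without bad points the trivial swap will do.
        refine ⟨(⟨0, hn⟩, ⟨0, hd⟩), (⟨0, hn⟩, ⟨0, hd⟩), ?_⟩
        rw [swap_self, Finset.not_nonempty_iff_eq_empty] at *
        change (badPoints ι (π * 1)).card ≤ k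
        rw [mul_one, hne]
        simp
    obtain ⟨x, z, h⟩ := key
    simp only [Finset.mem_biUnion, Finset.mem_univ, true_and, Finset.mem_image, Finset.mem_filter]
    exact ⟨(x, z), π * swap x z, h, by rw [mul_assoc, swap_mul_self, mul_one]⟩
  refine (Finset.card_le_card h).trans (Finset.card_biUnion_le.trans ?_)
  calc _ ≤ ∑ _p : (Fin n × Fin d) × (Fin n × Fin d),
        (Finset.univ.filter fun π : Perm (Fin n × Fin d) => (badPoints ι π).card ≤ k).card :=
        Finset.sum_le_sum fun p _ => Finset.card_image_le
    _ = _ := by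
        simp [sq]

lemma card_filter_badPoints_le_pow {ι : Fin n × Fin d → Fin n × Fin d}
    (hι : Function.Involutive ι) (hfix : ∀ x, ι x ≠ x) {K k : ℕ} (hk : k ≤ K)
    (hN : d * (2 * d + 3) + K < n * d) :
    (Finset.univ.filter fun π : Perm (Fin n × Fin d) => (badPoints ι π).card ≤ k).card ≤
      ((n * d) ^ 2) ^ k *
        (Finset.univ.filter fun π : Perm (Fin n × Fin d) => (badPoints ι π).card ≤ 0).card := by
  induction k with
  | zero => simp
  | succ k ih =>
    refine (card_filter_badPoints_le_mul hι hfix hk hN).trans ?_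
    rw [pow_succ' _ k, mul_assoc]
    exact Nat.mul_le_mul le_rfl (ih (by omega))

/-- At least a polynomially small proportion of all permutations has no bad point. -/
lemma factorial_le_mul_card_injective {ι : Fin n × Fin d → Fin n × Fin d}
    (hι : Function.Involutive ι) (hfix : ∀ x, ι x ≠ x) (hd : 1 ≤ d)
    (hN : d * (2 * d + 3) + (4 * d + 8 * d ^ 2) < n * d) :
    (n * d).factorial ≤ 2 * ((n * d) ^ 2) ^ (4 * d + 8 * d ^ 2) *
      (Finset.univ.filter fun π : Perm (Fin n × Fin d) =>
        (badPoints ι π).card ≤ 0).card := by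
  -- Twice the bound on the average number of bad points, so by Markov's inequality at least half of
  -- all permutations have at most `K`.
  set K := 4 * d + 8 * d ^ 2 with hK
  have h6 : 6 ≤ n * d := by nlinarith
  have h1 := sum_card_badPoints_le hι hfix h6
  have h2 := card_filter_badPoints_le_pow hι hfix le_rfl hN
  set S := Finset.univ.filter fun π : Perm (Fin n × Fin d) => (badPoints ι π).card ≤ K
  have h3 : (K + 1) * (Finset.univ.filter fun π : Perm (Fin n × Fin d) =>
      ¬ (badPoints ι π).card ≤ K).card ≤ ∑ π : Perm (Fin n × Fin d), (badPoints ι π).card := by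
    rw [mul_comm, ← smul_eq_mul]
    refine (Finset.card_nsmul_le_sum _ (fun π => (badPoints ι π).card) _ fun π hπ => ?_).trans
      (Finset.sum_le_sum_of_subset (Finset.filter_subset _ _))
    have := (Finset.mem_filter.1 hπ).2
    omega
  have h4 := Finset.card_filter_add_card_filter_not (s := Finset.univ)
    (fun π : Perm (Fin n × Fin d) => (badPoints ι π).card ≤ K)
  rw [Finset.card_univ, Fintype.card_perm, Fintype.card_prod, Fintype.card_fin,
    Fintype.card_fin] at h4
  have h5 : 2 * (2 * d + 4 * d ^ 2) = K := by rw [hK]; ring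
  have hK0 : 0 < K := by positivity
  set T := (Finset.univ.filter fun π : Perm (Fin n × Fin d) => ¬ (badPoints ι π).card ≤ K).card
  have h7 : (n * d).factorial ≤ 2 * S.card := by
    have : 2 * (K * T) ≤ K * (n * d).factorial := by
      calc 2 * (K * T) ≤ 2 * ((2 * d + 4 * d ^ 2) * (n * d).factorial) :=
            Nat.mul_le_mul le_rfl (le_trans (Nat.mul_le_mul (by omega) le_rfl) (h3.trans h1))
        _ = K * (n * d).factorial := by rw [← mul_assoc, h5]
    have : 2 * T ≤ (n * d).factorial := by
      refine Nat.le_of_mul_le_mul_left (c := K) ?_ hK0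
      linarith
    change S.card + T = _ at h4
    omega
  calc (n * d).factorial ≤ 2 * S.card := h7
    _ ≤ 2 * (_ * _) := Nat.mul_le_mul le_rfl h2
    _ = _ := by ring

end Switching

/-! ### Simple configurations -/

section SimpleConfigurations

open Equiv

variable {n d : ℕ}

/-- Flipping the Boolean in `Fin m × Bool` is a fixed-point-free involution whose orbits are the
matching edges. -/
lemma exists_perfect_matching_involution {X : Type*} [Fintype X] {m : ℕ}
    (hX : Fintype.card X = 2 * m) :
    ∃ M ∈ matchings X m, ∃ ι : X → X, Function.Involutive ι ∧ (∀ x, ι x ≠ x) ∧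
      (∀ x, s(x, ι x) ∈ M) ∧ ∀ e ∈ M, ∃ x, e = s(x, ι x) := by
  have u : Fin m × Bool ≃ X := Fintype.equivOfCardEq (by simp [hX, mul_comm])
  obtain ⟨M, hM, hMe⟩ := exists_matching_of_embedding u.toEmbedding
  refine ⟨M, hM, fun x => u ((u.symm x).1, !(u.symm x).2), fun x => by simp, ?_, ?_, ?_⟩
  · intro x h
    rw [← Equiv.eq_symm_apply] at h
    simpa using congrArg Prod.snd h
  · intro x
    obtain ⟨⟨i, b⟩, rfl⟩ := u.surjective x
    refine (hMe _).2 ⟨i, ?_⟩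
    cases b <;> simp [Sym2.eq_swap]
  · intro e he
    obtain ⟨i, rfl⟩ := (hMe e).1 he
    exact ⟨u (i, false), by simp⟩

lemma toMultigraph_injective {V : Type*} [Finite V] :
    Function.Injective (SimpleGraph.toMultigraph : SimpleGraph V → Multigraph V) := by
  intro G H h
  have h1 : G.edgeSet.toFinite.toFinset.val = H.edgeSet.toFinite.toFinset.val :=
    congrArg Multigraph.edges h
  have h2 := Finset.val_injective h1
  rwa [Set.Finite.toFinset_inj, SimpleGraph.edgeSet_inj] at h2

open Classical in
/-- The simple regular graphs. -/
noncomputable def regularGraphs (d n : ℕ) : Finset (SimpleGraph (Fin n)) :=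
  (Set.toFinite {G : SimpleGraph (Fin n) | G.IsRegularOfDegree d}).toFinset

lemma mem_regularGraphs {G : SimpleGraph (Fin n)} [G.LocallyFinite] :
    G ∈ regularGraphs d n ↔ G.IsRegularOfDegree d := by
  rw [regularGraphs, Set.Finite.mem_toFinset, Set.mem_ofPred_eq]
  unfold SimpleGraph.IsRegularOfDegree
  convert Iff.rfl

/-- A configuration without repeated darts projects to a simple regular graph. -/
lemma exists_regularGraph_of_injective {M : Finset (Sym2 (Fin n × Fin d))}
    {ι : Fin n × Fin d → Fin n × Fin d} (hι : Function.Involutive ι) (hfix : ∀ x, ι x ≠ x)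
    (hιM : ∀ x, s(x, ι x) ∈ M) (hMι : ∀ e ∈ M, ∃ x, e = s(x, ι x))
    {π : Perm (Fin n × Fin d)} (hπ : Function.Injective (dartAt ι π)) :
    ∃ G ∈ regularGraphs d n, projectEdges (M.map (permEdge π)) = G.toMultigraph := by
  classical
  have hswap : ∀ x, dartAt ι π (ι x) = (dartAt ι π x).swap := fun x => by simp [dartAt, hι x]
  let G : SimpleGraph (Fin n) :=
    { Adj := fun v w => ∃ x, dartAt ι π x = (v, w)
      symm := ⟨fun v w ⟨x, hx⟩ => ⟨ι x, by rw [hswap, hx]; rfl⟩⟩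
      loopless := ⟨fun v ⟨x, hx⟩ => hfix x (hπ (by rw [hswap, hx]; rfl))⟩ }
  have hG : ∀ v w, G.Adj v w ↔ ∃ x, dartAt ι π x = (v, w) := fun v w => Iff.rfl
  refine ⟨G, mem_regularGraphs.2 fun v => ?_, ?_⟩
  · rw [← SimpleGraph.card_neighborFinset_eq_degree]
    have h : G.neighborFinset v =
        (Finset.univ.filter fun x => (π x).1 = v).image fun x => (π (ι x)).1 := by
      ext w
      simp [hG, dartAt]
    rw [h, Finset.card_image_of_injOn, card_filter_fst_perm]
    intro x hx y hy hxy
    simp only [Finset.coe_filter, Finset.mem_univ, true_and, Set.mem_ofPred_eq] at hx hy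
    exact hπ (Prod.ext (hx.trans hy.symm) hxy)
  · have hφ : ∀ x, Sym2.map Prod.fst (Sym2.map π s(x, ι x)) =
        s((dartAt ι π x).1, (dartAt ι π x).2) := fun x => rfl
    -- Distinct matching edges project to distinct edges, so the projected multiset has no
    -- multiplicities and comes from a set.
    have hinj : Set.InjOn (fun e => Sym2.map Prod.fst (Sym2.map π e)) (M : Set (Sym2 _)) := by
      intro e he f hf hef
      obtain ⟨x, rfl⟩ := hMι e he
      obtain ⟨y, rfl⟩ := hMι f hf
      simp only [hφ, Sym2.eq_iff] at hef
      rcases hef with h | h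
      · rw [hπ (Prod.ext h.1 h.2)]
      · have : x = ι y := hπ (by rw [hswap]; exact Prod.ext h.1 h.2)
        rw [this, hι, Sym2.eq_swap]
    rw [projectEdges_map_permEdge, SimpleGraph.toMultigraph, ← Finset.image_val_of_injOn hinj]
    congr 2
    ext e
    simp only [Finset.mem_image, Set.Finite.mem_toFinset]
    constructor
    · rintro ⟨e, he, rfl⟩
      obtain ⟨x, rfl⟩ := hMι e he
      rw [hφ, SimpleGraph.mem_edgeSet, hG]
      exact ⟨x, rfl⟩
    · induction e with | _ v w
      intro h
      rw [SimpleGraph.mem_edgeSet, hG] at h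
      obtain ⟨x, hx⟩ := h
      exact ⟨s(x, ι x), hιM x, by rw [hφ, hx]⟩

end SimpleConfigurations

/-! ### Counting the configurations over a simple regular graph -/

section Fibres

variable {n d : ℕ}

/-- The assignments of the clones of each vertex to the darts emanating from it. -/
abbrev CloneAssignment (d : ℕ) (G : SimpleGraph (Fin n)) : Type :=
  {χ : G.Dart ≃ Fin n × Fin d // ∀ a, (χ a).1 = a.fst}

lemma exists_equiv_of_card_fiber_eq {A B V : Type*} [Fintype A] [Fintype B] [DecidableEq V]
    (f : A → V) (g : B → V) (h : ∀ v, Fintype.card {a // f a = v} = Fintype.card {b // g b = v}) :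
    ∃ θ : A ≃ B, ∀ a, g (θ a) = f a := by
  refine ⟨(Equiv.sigmaFiberEquiv f).symm.trans ((Equiv.sigmaCongrRight fun v =>
    Fintype.equivOfCardEq (h v)).trans (Equiv.sigmaFiberEquiv g)), fun a => ?_⟩
  simp only [Equiv.trans_apply]
  exact ((Fintype.equivOfCardEq (h (f a))) ⟨a, rfl⟩).2

lemma card_fiber_dart_fst {G : SimpleGraph (Fin n)} [DecidableRel G.Adj]
    (hG : G.IsRegularOfDegree d) (v : Fin n) : Fintype.card {a : G.Dart // a.fst = v} = d := by
  rw [Fintype.card_subtype, G.dart_fst_fiber_card_eq_degree, hG v]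

/-- Regularity puts `d` darts of either graph at each vertex, so the darts can be matched up
preserving first vertices. The bijection need not respect edges, as clone assignments are
constrained by first vertices only. -/
lemma exists_equiv_cloneAssignment {G H : SimpleGraph (Fin n)} (hG : G ∈ regularGraphs d n)
    (hH : H ∈ regularGraphs d n) : Nonempty (CloneAssignment d G ≃ CloneAssignment d H) := by
  classical
  rw [mem_regularGraphs] at hG hH
  obtain ⟨θ, hθ⟩ := exists_equiv_of_card_fiber_eq (fun a : G.Dart => a.fst)
    (fun a : H.Dart => a.fst) fun v => by rw [card_fiber_dart_fst hG, card_fiber_dart_fst hH]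
  have hθ' : ∀ a, (θ.symm a).fst = a.fst := fun a => by
    rw [← hθ, Equiv.apply_symm_apply]
  exact ⟨⟨fun χ => ⟨θ.symm.trans χ.1, fun a => by simp [χ.2, hθ']⟩,
    fun χ => ⟨θ.trans χ.1, fun a => by simp [χ.2, hθ]⟩,
    fun χ => by ext a : 2; simp, fun χ => by ext a : 2; simp⟩⟩

variable {G : SimpleGraph (Fin n)}

open Classical in
/-- The perfect matching of the clones defined by a clone assignment. -/
noncomputable def CloneAssignment.matching (χ : CloneAssignment d G) :
    Finset (Sym2 (Fin n × Fin d)) :=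
  Finset.univ.image fun a : G.Dart => s(χ.1 a, χ.1 a.symm)

lemma CloneAssignment.mem_matching {χ : CloneAssignment d G} {e : Sym2 (Fin n × Fin d)} :
    e ∈ χ.matching ↔ ∃ a : G.Dart, s(χ.1 a, χ.1 a.symm) = e := by
  simp [CloneAssignment.matching]

lemma CloneAssignment.map_fst (χ : CloneAssignment d G) (a : G.Dart) :
    Sym2.map Prod.fst s(χ.1 a, χ.1 a.symm) = a.edge := by
  rw [Sym2.map_mk, χ.2, χ.2]
  rfl

lemma CloneAssignment.mk_eq_of_edge_eq (χ : CloneAssignment d G) {a b : G.Dart}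
    (h : a.edge = b.edge) : s(χ.1 a, χ.1 a.symm) = s(χ.1 b, χ.1 b.symm) := by
  rcases (SimpleGraph.dart_edge_eq_iff a b).1 h with rfl | rfl
  · rfl
  · rw [SimpleGraph.Dart.symm_symm, Sym2.eq_swap]

lemma CloneAssignment.projectEdges_matching (χ : CloneAssignment d G) :
    projectEdges χ.matching = G.toMultigraph := by
  classical
  have hinj : Set.InjOn (Sym2.map Prod.fst) (χ.matching : Set (Sym2 (Fin n × Fin d))) := by
    intro e he f hf hef
    obtain ⟨a, rfl⟩ := mem_matching.1 he
    obtain ⟨b, rfl⟩ := mem_matching.1 hf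
    rw [χ.map_fst, χ.map_fst] at hef
    exact χ.mk_eq_of_edge_eq hef
  rw [projectEdges, SimpleGraph.toMultigraph, ← Finset.image_val_of_injOn hinj]
  congr 2
  ext e
  simp only [Finset.mem_image, Set.Finite.mem_toFinset]
  constructor
  · rintro ⟨e, he, rfl⟩
    obtain ⟨a, rfl⟩ := mem_matching.1 he
    rw [χ.map_fst]
    exact a.edge_mem
  · induction e with | _ v w
    intro h
    exact ⟨_, mem_matching.2 ⟨⟨(v, w), h⟩, rfl⟩, χ.map_fst _⟩

lemma two_mul_card_edges {G : SimpleGraph (Fin n)} (hG : G ∈ regularGraphs d n) :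
    2 * G.toMultigraph.edges.card = n * d := by
  classical
  rw [mem_regularGraphs] at hG
  have h := G.sum_degrees_eq_twice_card_edges
  simp only [hG.degree_eq, Finset.sum_const, Finset.card_univ, Fintype.card_fin,
    smul_eq_mul] at h
  rw [h, SimpleGraph.toMultigraph, Finset.card_val]
  congr 2
  ext e
  simp

lemma CloneAssignment.matching_mem {m : ℕ} (hG : G ∈ regularGraphs d n) (hm : 2 * m = n * d)
    (χ : CloneAssignment d G) : χ.matching ∈ matchings (Fin n × Fin d) m := by
  refine mem_matchings.2 ⟨?_, ?_, ?_⟩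
  · have h1 := two_mul_card_edges hG
    rw [← χ.projectEdges_matching, projectEdges, Multiset.card_map, Finset.card_val] at h1
    omega
  · intro e he
    obtain ⟨a, rfl⟩ := mem_matching.1 he
    rw [Sym2.mk_isDiag_iff, χ.1.injective.eq_iff]
    exact a.symm_ne.symm
  · intro e he f hf hef x hxe hxf
    obtain ⟨a, rfl⟩ := mem_matching.1 he
    obtain ⟨b, rfl⟩ := mem_matching.1 hf
    refine hef (χ.mk_eq_of_edge_eq ((SimpleGraph.dart_edge_eq_iff a b).2 ?_))
    rw [Sym2.mem_iff] at hxe hxf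
    rcases hxe with rfl | rfl <;> rcases hxf with h | h <;> have h := χ.1.injective h
    · exact Or.inl h
    · exact Or.inr h
    · exact Or.inr (by rw [← h, SimpleGraph.Dart.symm_symm])
    · exact Or.inl (SimpleGraph.Dart.symm_involutive.injective h)

/-- A clone determines its vertex, and a dart of a simple graph is determined by its two vertices;
so the matching edge above a dart reveals the clone assigned to it. -/
lemma CloneAssignment.matching_injective :
    Function.Injective (CloneAssignment.matching : CloneAssignment d G → _) := by
  intro χ χ' h
  ext a : 2
  have h1 : s(χ.1 a, χ.1 a.symm) ∈ χ'.matching := by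
    rw [← h]; exact mem_matching.2 ⟨a, rfl⟩
  obtain ⟨b, hb⟩ := mem_matching.1 h1
  rw [Sym2.eq_iff] at hb
  rcases hb with hb | hb
  · have h2 : b.fst = a.fst := by rw [← χ.2 a, ← χ'.2, hb.1]
    have h3 : b.snd = a.snd := by
      have := congrArg Prod.fst hb.2
      rwa [χ.2, χ'.2] at this
    rw [← hb.1, SimpleGraph.Dart.ext b a (Prod.ext h2 h3)]
  · have h2 : b.fst = a.snd := by
      have := congrArg Prod.fst hb.1
      rwa [χ.2, χ'.2] at this
    have h3 : b.snd = a.fst := by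
      have := congrArg Prod.fst hb.2
      rwa [χ.2, χ'.2] at this
    rw [← hb.2, SimpleGraph.Dart.ext b.symm a (Prod.ext h3 h2)]

/-- Simplicity of `G` makes the projection injective on `M`. Each dart thus lies below one matching
edge, and is assigned the end of that edge at its first vertex. Counting `n * d` darts upgrades
injectivity to bijectivity. -/
lemma CloneAssignment.exists_matching_eq {m : ℕ} (hG : G ∈ regularGraphs d n)
    (hm : 2 * m = n * d) {M : Finset (Sym2 (Fin n × Fin d))}
    (hM : M ∈ matchings (Fin n × Fin d) m) (hMG : projectEdges M = G.toMultigraph) :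
    ∃ χ : CloneAssignment d G, χ.matching = M := by
  classical
  have hedges : M.val.map (Sym2.map Prod.fst) = G.edgeSet.toFinite.toFinset.val :=
    congrArg Multigraph.edges hMG
  have hinj : ∀ e ∈ M, ∀ f ∈ M, Sym2.map Prod.fst e = Sym2.map Prod.fst f → e = f := by
    refine fun e he f hf h => Multiset.inj_on_of_nodup_map (f := Sym2.map Prod.fst) ?_ e he f hf h
    rw [hedges]
    exact Finset.nodup _
  have hex : ∀ a : G.Dart, ∃ x y : Fin n × Fin d, s(x, y) ∈ M ∧ x.1 = a.fst ∧ y.1 = a.snd := by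
    intro a
    have : a.edge ∈ M.val.map (Sym2.map Prod.fst) := by
      rw [hedges]; simp
    obtain ⟨e, he, hea⟩ := Multiset.mem_map.1 this
    induction e with | _ x y
    rw [Sym2.map_mk] at hea
    rcases Sym2.eq_iff.1 (hea : s(x.1, y.1) = s(a.fst, a.snd)) with h | h
    · exact ⟨x, y, he, h.1, h.2⟩
    · exact ⟨y, x, by rw [Sym2.eq_swap]; exact he, h.2, h.1⟩
  choose x y hxy hx hy using hex
  have hsymm : ∀ a, x a.symm = y a := by
    intro a
    have h1 : s(x a.symm, y a.symm) = s(x a, y a) := by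
      refine hinj _ (hxy _) _ (hxy _) ?_
      rw [Sym2.map_mk, Sym2.map_mk, hx, hy, hx, hy]
      exact Sym2.eq_swap
    rcases Sym2.eq_iff.1 h1 with h | h
    · have h2 := congrArg Prod.fst h.1
      rw [hx, hx] at h2
      exact absurd h2 a.adj.ne'
    · exact h.1
  have hxinj : Function.Injective x := by
    intro a b hab
    have h1 := eq_of_mem_of_mem_matching hM (hxy a) (hxy b) (x := x a) (by simp) (by simp [hab])
    rw [hab, Sym2.congr_right] at h1
    have h2 : a.fst = b.fst := by rw [← hx, ← hx, hab]
    have h3 : a.snd = b.snd := by rw [← hy, ← hy, h1]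
    exact SimpleGraph.Dart.ext _ _ (Prod.ext h2 h3)
  have hcard : Fintype.card G.Dart = Fintype.card (Fin n × Fin d) := by
    rw [G.dart_card_eq_sum_degrees]
    have hG' := mem_regularGraphs.1 hG
    simp [hG'.degree_eq]
  have hbij : Function.Bijective x := (Fintype.bijective_iff_injective_and_card x).2 ⟨hxinj, hcard⟩
  let χ : CloneAssignment d G := ⟨Equiv.ofBijective x hbij, hx⟩
  refine ⟨χ, Finset.eq_of_subset_of_card_le (fun e he => ?_) ?_⟩
  · obtain ⟨a, rfl⟩ := mem_matching.1 he
    change s(x a, x a.symm) ∈ M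
    rw [hsymm]
    exact hxy a
  · rw [(mem_matchings.1 hM).1, (mem_matchings.1 (χ.matching_mem hG hm)).1]

open Classical in
/-- Each simple regular graph arises from the same number of configurations. -/
lemma exists_card_fiber_projectEdges {m : ℕ} (hm : 2 * m = n * d) : ∃ c : ℕ,
    ∀ G ∈ regularGraphs d n, ((matchings (Fin n × Fin d) m).filter fun M =>
      projectEdges M = G.toMultigraph).card = c := by
  by_cases hne : (regularGraphs d n).Nonempty
  · obtain ⟨H, hH⟩ := hne
    -- The value is (d!)^n, but only its independence of the graph matters.
    refine ⟨Nat.card (CloneAssignment d H), fun G hG => ?_⟩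
    obtain ⟨θ⟩ := exists_equiv_cloneAssignment hG hH
    rw [← Nat.card_congr θ, Nat.card_eq_fintype_card, ← Finset.card_univ]
    symm
    refine Finset.card_bij (fun χ _ => χ.matching) (fun χ _ => ?_)
      (fun χ _ χ' _ h => CloneAssignment.matching_injective h) fun M hM => ?_
    · exact Finset.mem_filter.2 ⟨χ.matching_mem hG hm, χ.projectEdges_matching⟩
    · rw [Finset.mem_filter] at hM
      obtain ⟨χ, hχ⟩ := CloneAssignment.exists_matching_eq hG hm hM.1 hM.2
      exact ⟨χ, Finset.mem_univ _, hχ⟩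
  · exact ⟨0, fun G hG => absurd ⟨G, hG⟩ hne⟩

end Fibres

/-! ### From the configuration model to the random regular graph -/

section RandomRegularGraph

open Equiv

variable {n d : ℕ}

lemma regularGraph_eq_uniformOn (d n : ℕ) :
    regularGraph d n = uniformOn (regularGraphs d n : Set (SimpleGraph (Fin n))) := by
  rw [regularGraph, regularGraphs, Set.Finite.coe_toFinset]

open Classical in
lemma regularGraph_real_mul_card (B : Set (SimpleGraph (Fin n)))
    (hne : (regularGraphs d n).Nonempty) :
    (regularGraph d n).real B * (regularGraphs d n).card =
      ((regularGraphs d n).filter fun G => G ∈ B).card := by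
  have hB : B = ((Finset.univ.filter fun G => G ∈ B : Finset (SimpleGraph (Fin n))) : Set _) := by
    ext G; simp
  have h0 : ((regularGraphs d n).card : ℝ) ≠ 0 := by exact_mod_cast hne.card_ne_zero
  conv_lhs => rw [hB]
  rw [regularGraph_eq_uniformOn, measureReal_def, uniformOn_apply_finset, ENNReal.toReal_div,
    ENNReal.toReal_natCast, ENNReal.toReal_natCast, div_mul_cancel₀ _ h0, Finset.inter_filter,
    Finset.inter_univ]

open Classical in
lemma card_matchings_mul_configurationModel_real (m : ℕ) (A : Set (Multigraph (Fin n)))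
    (hne : (matchings (Fin n × Fin d) m).Nonempty) :
    (configurationModel d n m).real A * (matchings (Fin n × Fin d) m).card =
      ((matchings (Fin n × Fin d) m).filter fun M => projectEdges M ∈ A).card := by
  have h0 : ((matchings (Fin n × Fin d) m).card : ℝ) ≠ 0 := by exact_mod_cast hne.card_ne_zero
  rw [← integral_indicator_one .of_discrete, configurationModel,
    integral_uniformLaw _ _ .of_discrete, mul_comm, mul_inv_cancel_left₀ h0]
  simp only [Set.indicator_apply, Pi.one_apply, Finset.sum_boole, projectEdges]
  congr!

open Classical in
/-- At least a polynomially small proportion of all configurations projects to a simple graph. -/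
lemma card_matchings_le_mul_card_simple {m : ℕ} (hd : 1 ≤ d) (hm : 2 * m = n * d)
    (hN : d * (2 * d + 3) + (4 * d + 8 * d ^ 2) < n * d) :
    (matchings (Fin n × Fin d) m).card ≤ 2 * ((n * d) ^ 2) ^ (4 * d + 8 * d ^ 2) *
      ((matchings (Fin n × Fin d) m).filter fun M =>
        ∃ G ∈ regularGraphs d n, projectEdges M = G.toMultigraph).card := by
  set L := 2 * ((n * d) ^ 2) ^ (4 * d + 8 * d ^ 2)
  obtain ⟨M₀, hM₀, ι, hι, hfix, hιM, hMι⟩ := exists_perfect_matching_involution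
    (X := Fin n × Fin d) (m := m) (by simp [hm])
  have h1 := factorial_le_mul_card_injective hι hfix hd hN
  have h2 := wmean_perm_matching hM₀ fun M =>
    if ∃ G ∈ regularGraphs d n, projectEdges M = G.toMultigraph then (1 : ℝ) else 0
  rw [Finset.sum_boole] at h2
  have h3 : (Finset.univ.filter fun π : Perm (Fin n × Fin d) => (badPoints ι π).card ≤ 0).card ≤
      (Finset.univ.filter fun π : Perm (Fin n × Fin d) => ∃ G ∈ regularGraphs d n,
        projectEdges (M₀.map (permEdge π)) = G.toMultigraph).card := by
    refine Finset.card_le_card fun π hπ => ?_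
    rw [Finset.mem_filter, Nat.le_zero, Finset.card_eq_zero, badPoints_eq_empty_iff] at hπ
    exact Finset.mem_filter.2 ⟨Finset.mem_univ _,
      exists_regularGraph_of_injective hι hfix hιM hMι hπ.2⟩
  have h4 : ((n * d).factorial : ℝ) ≤ L * (Finset.univ.filter fun π : Perm (Fin n × Fin d) =>
      ∃ G ∈ regularGraphs d n, projectEdges (M₀.map (permEdge π)) = G.toMultigraph).card := by
    exact_mod_cast h1.trans (Nat.mul_le_mul le_rfl h3)
  simp only [wmean, unifWeight, ← Finset.mul_sum, Finset.sum_boole, Fintype.card_perm,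
    Fintype.card_prod, Fintype.card_fin] at h2
  have hc : (0 : ℝ) < (matchings (Fin n × Fin d) m).card := by
    exact_mod_cast Finset.card_pos.2 ⟨M₀, hM₀⟩
  have hf : (0 : ℝ) < (n * d).factorial := by exact_mod_cast Nat.factorial_pos _
  rw [inv_mul_eq_div, inv_mul_eq_div, div_eq_div_iff hc.ne' hf.ne'] at h2
  have h5 : ((matchings (Fin n × Fin d) m).card : ℝ) ≤
      L * ((matchings (Fin n × Fin d) m).filter fun M =>
        ∃ G ∈ regularGraphs d n, projectEdges M = G.toMultigraph).card := by
    refine le_of_mul_le_mul_right ?_ hf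
    rw [mul_assoc, h2]
    calc _ ≤ ((matchings (Fin n × Fin d) m).card : ℝ) * (L * _) :=
          mul_le_mul_of_nonneg_left h4 hc.le
      _ = _ := by ring
  exact_mod_cast h5

/-- Events that are unlikely in the configuration model are unlikely in the random regular
graph. -/
lemma regularGraph_real_le {m : ℕ} (hd : 1 ≤ d) (hm : 2 * m = n * d)
    (hN : d * (2 * d + 3) + (4 * d + 8 * d ^ 2) < n * d) :
    (regularGraphs d n).Nonempty ∧ ∀ A : Set (Multigraph (Fin n)),
      (regularGraph d n).real {G | G.toMultigraph ∈ A} ≤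
        2 * ((n * d : ℝ) ^ 2) ^ (4 * d + 8 * d ^ 2) * (configurationModel d n m).real A := by
  classical
  have h1 := card_matchings_le_mul_card_simple hd hm hN
  obtain ⟨c, hc⟩ := exists_card_fiber_projectEdges hm
  have hne : (matchings (Fin n × Fin d) m).Nonempty :=
    matchings_nonempty (by simp [hm])
  set S := (matchings (Fin n × Fin d) m).filter fun M =>
    ∃ G ∈ regularGraphs d n, projectEdges M = G.toMultigraph with hS
  -- With `c` configurations above each regular graph, this bounds the simple configurations from
  -- above, and `h3` bounds those in `A` from below; in the quotient `c` cancels.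
  have h2 : S.card ≤ (regularGraphs d n).card * c := by
    have hsub : S ⊆ (regularGraphs d n).biUnion fun G =>
        (matchings (Fin n × Fin d) m).filter fun M => projectEdges M = G.toMultigraph := by
      intro M hM
      obtain ⟨hM, G, hG, hMG⟩ := Finset.mem_filter.1 hM
      exact Finset.mem_biUnion.2 ⟨G, hG, Finset.mem_filter.2 ⟨hM, hMG⟩⟩
    refine (Finset.card_le_card hsub).trans (Finset.card_biUnion_le.trans ?_)
    rw [Finset.sum_congr rfl hc, Finset.sum_const, smul_eq_mul]
  -- Existence of regular graphs is a by-product: were it to fail, no configuration would be simple,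
  -- contradicting `h1`.
  have hpos : 0 < (regularGraphs d n).card * c := by
    refine Nat.pos_of_ne_zero fun h => ?_
    have hS0 : S.card = 0 := by omega
    rw [hS0, mul_zero] at h1
    exact absurd hne.card_pos (by omega)
  have hreg : (regularGraphs d n).Nonempty := Finset.card_pos.1 (Nat.pos_of_mul_pos_right hpos)
  refine ⟨hreg, fun A => ?_⟩
  have h3 : ((regularGraphs d n).filter fun G => G.toMultigraph ∈ A).card * c ≤
      ((matchings (Fin n × Fin d) m).filter fun M => projectEdges M ∈ A).card := by
    rw [← smul_eq_mul, ← Finset.sum_const, ← Finset.sum_congr rfl fun G hG =>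
      hc G (Finset.mem_filter.1 hG).1, ← Finset.card_biUnion]
    · refine Finset.card_le_card fun M hM => ?_
      obtain ⟨G, hG, hM⟩ := Finset.mem_biUnion.1 hM
      rw [Finset.mem_filter] at hM hG ⊢
      exact ⟨hM.1, hM.2 ▸ hG.2⟩
    · intro G _ H _ hGH
      rw [Function.onFun, Finset.disjoint_left]
      intro M hM hM'
      rw [Finset.mem_filter] at hM hM'
      exact hGH (toMultigraph_injective (hM.2.symm.trans hM'.2))
  have h4 := regularGraph_real_mul_card {G | G.toMultigraph ∈ A} hreg
  have h5 := card_matchings_mul_configurationModel_real m A hne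
  have h1' : ((matchings (Fin n × Fin d) m).card : ℝ) ≤
      2 * ((n * d : ℝ) ^ 2) ^ (4 * d + 8 * d ^ 2) * ((regularGraphs d n).card * c) := by
    exact_mod_cast h1.trans (Nat.mul_le_mul le_rfl h2)
  have h3' : (((regularGraphs d n).filter fun G => G.toMultigraph ∈ A).card : ℝ) * c ≤
      ((matchings (Fin n × Fin d) m).filter fun M => projectEdges M ∈ A).card := by
    exact_mod_cast h3
  have hpos' : (0 : ℝ) < (regularGraphs d n).card * c := by exact_mod_cast hpos
  refine le_of_mul_le_mul_right ?_ hpos'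
  simp only [Set.mem_ofPred_eq] at h4
  rw [← mul_assoc, h4]
  refine h3'.trans ?_
  rw [← h5, mul_comm]
  refine (mul_le_mul_of_nonneg_right h1' measureReal_nonneg).trans (le_of_eq ?_)
  ring

/-- Tails are imported from the configuration model with all `d * n / 2` edges, so the mean of log Z
in that model is the natural centre; recentring then yields the deviation from the regular graph's
own mean. -/
theorem exists_rate_regularGraph {q : ℕ} (hq : 1 ≤ q) {δ β : ℝ} (hδ : 0 < δ) (hβ : 0 < β)
    {d : ℕ} (hd : 1 ≤ d) :
    ∃ ξ : ℝ, 0 < ξ ∧ ∀ᶠ n : ℕ in atTop, Even (d * n) →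
      deviationProb (regularGraph d n) (fun G => G.toMultigraph.logZ q β) (δ * n)
        ≤ Real.exp (-ξ * n) := by
  have hlarge : ∀ᶠ n : ℕ in atTop, d * (2 * d + 3) + (4 * d + 8 * d ^ 2) < n * d := by
    filter_upwards [eventually_gt_atTop (d * (2 * d + 3) + (4 * d + 8 * d ^ 2))] with n hn
    exact hn.trans_le (Nat.le_mul_of_pos_right n hd)
  have htwo : ∀ {n : ℕ}, Even (d * n) → 2 * (d * n / 2) = n * d := fun h => by
    rw [Nat.two_mul_div_two_of_even h, mul_comm]
  have hcast : ∀ {n : ℕ}, ((d * n / 2 : ℕ) : ℝ) ≤ d * n / 2 := fun {n} => by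
    have := @Nat.cast_div_le ℝ _ _ _ (d * n) 2
    exact_mod_cast this
  refine exists_rate_deviationProb (fun n => regularGraph d n)
    (fun n G => G.toMultigraph.logZ q β) (fun n => .of_discrete)
    (fun n => ∫ G, G.logZ q β ∂configurationModel d n (d * n / 2)) (β * d)
    (fun n => Even (d * n)) ?_ (fun s hs => ?_) hδ
  · filter_upwards [hlarge] with n hn heven
    have hreg := (regularGraph_real_le hd (htwo heven) hn).1
    rw [regularGraph_eq_uniformOn]
    refine ⟨isProbabilityMeasure_uniformOn (Finset.finite_toSet _) (by simpa using hreg), ?_⟩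
    rw [uniformOn]
    filter_upwards [ae_cond_mem (μ := Measure.count)
      (s := (regularGraphs d n : Set (SimpleGraph (Fin n)))) .of_discrete] with G hG
    have hne : (matchings (Fin n × Fin d) (d * n / 2)).Nonempty :=
      matchings_nonempty (by simp [htwo heven])
    have : IsProbabilityMeasure (configurationModel d n (d * n / 2)) :=
      isProbabilityMeasure_uniformLaw _ _ hne
    have hae : ∀ᵐ G ∂configurationModel d n (d * n / 2), G.edges.card = d * n / 2 :=
      ae_uniformLaw _ _ .of_discrete fun M hM => by simpa using (mem_matchings.1 hM).1
    have e1 := abs_integral_logZ_sub_le hq hβ.le hae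
    have e2 := abs_logZ_sub_logZ_empty_le hq hβ.le G.toMultigraph
    have e0 : G.toMultigraph.edges.card = d * n / 2 := by
      have h1 := two_mul_card_edges (Finset.mem_coe.1 hG)
      have h2 := htwo heven
      omega
    rw [e0] at e2
    have e3 : β * ((d * n / 2 : ℕ) : ℝ) ≤ β * (d * n / 2) := by gcongr; exact hcast
    rw [abs_le] at *
    constructor <;> linarith
  · obtain ⟨c, hc, h⟩ := configurationModel_tail_le hq hβ.le (d := d) hs
    refine ⟨c / 2, by positivity, ?_⟩
    -- The cost of simplicity is a polynomial in `n` of degree `2 * (4 * d + 8 * d ^ 2)`, paid for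
    -- by half of the rate.
    filter_upwards [hlarge, h, eventually_mul_exp_le (2 * ((d : ℝ) ^ 2) ^ (4 * d + 8 * d ^ 2))
      (2 * (4 * d + 8 * d ^ 2)) hc] with n hn htail hexp heven
    refine ((regularGraph_real_le hd (htwo heven) hn).2
      {G | s * n < |G.logZ q β - ∫ G, G.logZ q β ∂configurationModel d n (d * n / 2)|}).trans ?_
    refine (mul_le_mul_of_nonneg_left (htail _ hcast) (by positivity)).trans
      (le_trans (le_of_eq ?_) hexp)
    rw [mul_pow, mul_pow, ← pow_mul (n : ℝ)]
    ring

end RandomRegularGraph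

theorem proposition2p1 (q : ℕ) (hq : 1 ≤ q) (ε δ β : ℝ) (hε : 0 < ε) (hε1 : ε ≤ 1)
    (hδ : 0 < δ) (hβ : 0 < β) :
    (∀ d : ℝ, 0 < d → ∃ ξ : ℝ, 0 < ξ ∧ ∀ᶠ n : ℕ in atTop,
      deviationProb (binomialGraph d n) (fun G => G.toMultigraph.logZ q β) (δ * n)
          ≤ Real.exp (-ξ * n) ∧
      deviationProb (sparsifiedBinomial ε d n) (fun G => G.logZ q β) (δ * n)
          ≤ Real.exp (-ξ * n)) ∧
    (∀ d : ℕ, 1 ≤ d → ∃ ξ : ℝ, 0 < ξ ∧ ∀ᶠ n : ℕ in atTop,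
      (Even (d * n) →
        deviationProb (regularGraph d n) (fun G => G.toMultigraph.logZ q β) (δ * n)
          ≤ Real.exp (-ξ * n)) ∧
      deviationProb (sparsifiedRegular ε d n) (fun G => G.logZ q β) (δ * n)
          ≤ Real.exp (-ξ * n)) := by
  have hmin : ∀ (ξ₁ ξ₂ : ℝ) (n : ℕ), Real.exp (-ξ₁ * n) ≤ Real.exp (-min ξ₁ ξ₂ * n) ∧
      Real.exp (-ξ₂ * n) ≤ Real.exp (-min ξ₁ ξ₂ * n) := by
    intro ξ₁ ξ₂ n
    constructor <;> gcongr
    · exact min_le_left _ _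
    · exact min_le_right _ _
  refine ⟨fun d hd => ?_, fun d hd => ?_⟩
  · obtain ⟨ξ₁, hξ₁, h₁⟩ := exists_rate_binomialGraph hq hδ hβ hd
    obtain ⟨ξ₂, hξ₂, h₂⟩ := exists_rate_sparsifiedBinomial hq hε hε1 hδ hβ hd
    refine ⟨min ξ₁ ξ₂, lt_min hξ₁ hξ₂, ?_⟩
    filter_upwards [h₁, h₂] with n h₁ h₂
    exact ⟨h₁.trans (hmin ξ₁ ξ₂ n).1, h₂.trans (hmin ξ₁ ξ₂ n).2⟩
  · obtain ⟨ξ₁, hξ₁, h₁⟩ := exists_rate_regularGraph hq hδ hβ hd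
    obtain ⟨ξ₂, hξ₂, h₂⟩ := exists_rate_sparsifiedRegular hq hε hε1 hδ hβ hd
    refine ⟨min ξ₁ ξ₂, lt_min hξ₁ hξ₂, ?_⟩
    filter_upwards [h₁, h₂] with n h₁ h₂
    exact ⟨fun he => (h₁ he).trans (hmin ξ₁ ξ₂ n).1, h₂.trans (hmin ξ₁ ξ₂ n).2⟩
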